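/- Let $T$ be the $3$-regular (ternary) infinite rooted tree and let $\psi\colon \operatorname{Aut} T\to \operatorname{Aut} T\wr \operatorname{Sym}(3)$ be the isomorphism obtained by identifying the three subtrees rooted at the first level with $T$; on the stabilizer of the first level it is $g\mapsto (g_1,g_2,g_3)$, where $g_i$ is the action of $g$ on the $i$-th of these subtrees. Let $\mathcal G=\langle a,b\rangle\le\operatorname{Aut}T$ be the GGS-group with constant defining vector: $a$ permutes the three first-level subtrees rigidly according to the cycle $(1\,2\,3)$, and $b$ is defined recursively by $\psi(b)=(a,a,b)$. Let $K=\langle ba^{-1}\rangle^{\mathcal G}$ be the normal closure of $ba^{-1}$ in $\mathcal G$. Write $H'=[H,H]$, $H''=(H')'$ and $\gamma_3(H)=[[H,H],H]$ for a group $H$. Then $\mathcal G$ has the $3$-congruence subgroup property ($3$-CSP): for every normal subgroup $N$ of $\mathcal G$ such that $\mathcal G/N$ is a finite $3$-group there is an $n$ such that $N$ contains the subgroup $\operatorname{st}_{\mathcal G}(n)$ of all elements of $\mathcal G$ that fix every vertex of level $n$. Moreover, \[ \psi(\mathcal G'')=K'\times K'\times K',\qquad \mathcal G''\le\gamma_3(K),\qquad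 \psi(K'')\ge \mathcal G''\times\mathcal G''\times\mathcal G''. \] -/

import Mathlib

/-- The automorphism group of the `d`-regular infinite rooted tree. The vertices are the finite
words over the alphabet `Fin d`, the root is the empty word, the level of a vertex is its length,
and the vertex `u` lies on the path from the root to `v` exactly when `u` is a prefix of `v`. -/
def TreeAut (d : ℕ) : Subgroup (Equiv.Perm (List (Fin d))) where
  carrier := {g | (∀ w, (g w).length = w.length) ∧ ∀ u v, g u <+: g v ↔ u <+: v}
  one_mem' := ⟨fun _ => rfl, fun _ _ => Iff.rfl⟩
  mul_mem' := by
    rintro g h ⟨hg, hg'⟩ ⟨hh, hh'⟩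
    exact ⟨fun w => by simp [hg, hh], fun u v => by simp [hg', hh']⟩
  inv_mem' := by
    rintro g ⟨hg, hg'⟩
    exact ⟨fun w => by simpa using (hg (g⁻¹ w)).symm,
      fun u v => by simpa using (hg' (g⁻¹ u) (g⁻¹ v)).symm⟩

namespace TreeAut

variable {d : ℕ}

theorem length_apply (g : TreeAut d) (w : List (Fin d)) : (g.1 w).length = w.length :=
  g.2.1 w

theorem prefix_iff (g : TreeAut d) (u v : List (Fin d)) : g.1 u <+: g.1 v ↔ u <+: v :=
  g.2.2 u v

/-- The stabilizer `st(n)` of level `n`: automorphisms that fix every vertex of level `n`. -/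
def levelStab (d n : ℕ) : Subgroup (TreeAut d) where
  carrier := {g | ∀ w : List (Fin d), w.length = n → g.1 w = w}
  one_mem' := fun _ _ => rfl
  mul_mem' := by
    intro g h hg hh w hw
    simp [hh w hw, hg w hw]
  inv_mem' := by
    intro g hg w hw
    have h := hg w hw
    simpa using (congrArg (g⁻¹).1 h).symm

/-! ### The decomposition on the first level -/

theorem apply_singleton (g : TreeAut d) (x : Fin d) : ∃ y, g.1 [x] = [y] :=
  List.length_eq_one_iff.1 (by simpa using length_apply g [x])

/-- The image of the first-level vertex `x`. -/
def rootFun (g : TreeAut d) (x : Fin d) : Fin d :=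
  (g.1 [x]).head (by obtain ⟨y, hy⟩ := apply_singleton g x; simp [hy])

theorem apply_singleton_eq (g : TreeAut d) (x : Fin d) : g.1 [x] = [rootFun g x] := by
  obtain ⟨y, hy⟩ := apply_singleton g x
  simp [rootFun, hy]

/-- The map induced by `g` from the subtree rooted at the first-level vertex `x` to the subtree
rooted at its image, both subtrees being identified with the whole tree. -/
def secFun (g : TreeAut d) (x : Fin d) (w : List (Fin d)) : List (Fin d) :=
  (g.1 (x :: w)).tail

theorem apply_cons (g : TreeAut d) (x : Fin d) (w : List (Fin d)) :
    g.1 (x :: w) = rootFun g x :: secFun g x w := by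
  have h : g.1 [x] <+: g.1 (x :: w) := (prefix_iff g _ _).2 (by simp)
  rw [apply_singleton_eq] at h
  obtain ⟨t, ht⟩ := h
  simp [secFun, ← ht]

theorem rootFun_mul (g h : TreeAut d) (x : Fin d) :
    rootFun (g * h) x = rootFun g (rootFun h x) := by
  have h1 := apply_singleton_eq (g * h) x
  have h2 : (g * h).1 [x] = [rootFun g (rootFun h x)] := by
    simp [apply_singleton_eq]
  simpa using h1.symm.trans h2

theorem rootFun_one (x : Fin d) : rootFun (1 : TreeAut d) x = x := by
  simpa using (apply_singleton_eq (1 : TreeAut d) x).symm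

theorem secFun_mul (g h : TreeAut d) (x : Fin d) (w : List (Fin d)) :
    secFun (g * h) x w = secFun g (rootFun h x) (secFun h x w) := by
  have h2 : (g * h).1 (x :: w) = g.1 (h.1 (x :: w)) := rfl
  rw [apply_cons, apply_cons h, apply_cons g] at h2
  exact (List.cons.inj h2).2

theorem secFun_one (x : Fin d) (w : List (Fin d)) : secFun (1 : TreeAut d) x w = w := rfl

/-- The permutation of the first level induced by `g`. -/
def rootPerm (g : TreeAut d) : Equiv.Perm (Fin d) where
  toFun := rootFun g
  invFun := rootFun g⁻¹
  left_inv x := by rw [← rootFun_mul, inv_mul_cancel, rootFun_one]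
  right_inv x := by rw [← rootFun_mul, mul_inv_cancel, rootFun_one]

/-- The section `g_x` of `g` at the first-level vertex `x`: `g (x w) = (g x) (g_x w)`. -/
def sec (g : TreeAut d) (x : Fin d) : TreeAut d :=
  ⟨{ toFun := secFun g x
     invFun := secFun g⁻¹ (rootFun g x)
     left_inv := fun w => by rw [← secFun_mul, inv_mul_cancel, secFun_one]
     right_inv := fun w => by
       have hx : rootFun g⁻¹ (rootFun g x) = x := by
         rw [← rootFun_mul, inv_mul_cancel, rootFun_one]
       have h := secFun_mul g g⁻¹ (rootFun g x) w
       rw [hx, mul_inv_cancel, secFun_one] at h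
       exact h.symm },
    fun w => by simpa [apply_cons] using length_apply g (x :: w),
    fun u v => by simpa [apply_cons] using prefix_iff g (x :: u) (x :: v)⟩

theorem apply_cons' (g : TreeAut d) (x : Fin d) (w : List (Fin d)) :
    g.1 (x :: w) = rootPerm g x :: (sec g x).1 w :=
  apply_cons g x w

theorem apply_nil (g : TreeAut d) : g.1 [] = [] :=
  List.length_eq_zero_iff.1 (by simpa using length_apply g [])

theorem ext_cons {g h : TreeAut d} (H : ∀ x w, g.1 (x :: w) = h.1 (x :: w)) : g = h := by
  apply Subtype.ext
  apply Equiv.ext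
  rintro (_ | ⟨x, w⟩)
  · rw [apply_nil, apply_nil]
  · exact H x w

/-- The permutational wreath product `A ≀ Sym(d)`, where `σ ∈ Sym(d)` acts on `A × ⋯ × A` by
`(σ • F) y = F (σ⁻¹ y)`. -/
abbrev Wreath (A : Type) [Group A] (d : ℕ) : Type :=
  (Fin d → A) ⋊[mulAutArrow (G := Equiv.Perm (Fin d)) (A := Fin d) (M := A)] Equiv.Perm (Fin d)

/-- The automorphism that permutes the first level by `σ` and maps the subtree at `x` to the
subtree at `σ x` by `F (σ x)`. -/
def ofWreath (F : Fin d → TreeAut d) (σ : Equiv.Perm (Fin d)) : TreeAut d :=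
  ⟨{ toFun := fun w => match w with
        | [] => []
        | x :: w => σ x :: (F (σ x)).1 w
     invFun := fun w => match w with
        | [] => []
        | y :: w => σ.symm y :: (F y).1.symm w
     left_inv := by rintro (_ | ⟨x, w⟩) <;> simp
     right_inv := by rintro (_ | ⟨x, w⟩) <;> simp },
    by rintro (_ | ⟨x, w⟩) <;> simp [length_apply],
    by
      rintro (_ | ⟨x, u⟩) (_ | ⟨y, v⟩)
      · simp
      · simp
      · simp
      · simp only [Equiv.coe_fn_mk, List.cons_prefix_cons, EmbeddingLike.apply_eq_iff_eq]
        constructor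
        · rintro ⟨rfl, h⟩
          exact ⟨rfl, (prefix_iff _ _ _).1 h⟩
        · rintro ⟨rfl, h⟩
          exact ⟨rfl, (prefix_iff _ _ _).2 h⟩⟩

theorem ofWreath_cons (F : Fin d → TreeAut d) (σ : Equiv.Perm (Fin d)) (x : Fin d)
    (w : List (Fin d)) : (ofWreath F σ).1 (x :: w) = σ x :: (F (σ x)).1 w := rfl

/-- The isomorphism `ψ : Aut T → Aut T ≀ Sym(d)`. On the first level stabilizer it is
`g ↦ (g_1, …, g_d)`, the tuple of the sections of `g`. -/
def psi (d : ℕ) : TreeAut d ≃* Wreath (TreeAut d) d where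
  toFun g := ⟨fun y => sec g ((rootPerm g).symm y), rootPerm g⟩
  invFun p := ofWreath p.left p.right
  left_inv g := ext_cons fun x w => by
    rw [ofWreath_cons, apply_cons']
    simp
  right_inv p := by
    have h1 : ∀ x w, rootPerm (ofWreath p.left p.right) x = p.right x ∧
        (sec (ofWreath p.left p.right) x).1 w = (p.left (p.right x)).1 w := fun x w => by
      have h := apply_cons' (ofWreath p.left p.right) x w
      rw [ofWreath_cons] at h
      exact ⟨(List.cons.inj h).1.symm, (List.cons.inj h).2.symm⟩
    have h2 : rootPerm (ofWreath p.left p.right) = p.right := Equiv.ext fun x => (h1 x []).1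
    refine SemidirectProduct.ext (funext fun y => ?_) h2
    apply Subtype.ext
    apply Equiv.ext
    intro w
    simp only [h2]
    rw [(h1 _ w).2]
    simp
  map_mul' g h := by
    have h1 : ∀ x, rootPerm (g * h) x = rootPerm g (rootPerm h x) := rootFun_mul g h
    have h2 : rootPerm (g * h) = rootPerm g * rootPerm h := Equiv.ext h1
    have h3 : ∀ x, sec (g * h) x = sec g (rootPerm h x) * sec h x := fun x =>
      Subtype.ext (Equiv.ext (secFun_mul g h x))
    refine SemidirectProduct.ext (funext fun y => ?_) h2
    simp only [h2, h3]
    change sec g (rootPerm h ((rootPerm h).symm ((rootPerm g).symm y))) * _ = _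
    rw [Equiv.apply_symm_apply]
    rfl

/-- For `H ≤ Aut T`, the subgroup `H × ⋯ × H` (`d` factors) of the base group of
`Aut T ≀ Sym(d)`. -/
def basePower (H : Subgroup (TreeAut d)) : Subgroup (Wreath (TreeAut d) d) :=
  (Subgroup.pi Set.univ fun _ : Fin d => H).map SemidirectProduct.inl

/-! ### The congruence subgroup property -/

/-- `G` has the `C`-congruence subgroup property, for a class `C` of finite groups: every normal
subgroup `N` of `G` with `G/N` in `C` contains some level stabilizer `st_G(n)`. -/
def HasCSP (C : (Q : Type) → [Group Q] → Prop) (G : Subgroup (TreeAut d)) : Prop :=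
  ∀ (N : Subgroup G) [N.Normal], C (G ⧸ N) → ∃ n : ℕ, (levelStab d n).subgroupOf G ≤ N

/-- The `p`-congruence subgroup property: the case where `C` is the class of finite `p`-groups. -/
def HasPCSP (p : ℕ) (G : Subgroup (TreeAut d)) : Prop :=
  HasCSP (fun Q _ => Finite Q ∧ IsPGroup p Q) G

/-! ### The GGS-group with constant defining vector -/

/-- The generator `a`: it permutes the first-level subtrees cyclically. -/
def ggsA (d : ℕ) : TreeAut d := ofWreath (fun _ => 1) (finRotate d)

/-- The action of the generator `b` (for `k = 1`) and of its inverse (for `k = -1`) on words. -/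
def ggsBFun (d : ℕ) (k : ℤ) : List (Fin d) → List (Fin d)
  | [] => []
  | x :: w => x :: if (x : ℕ) + 1 = d then ggsBFun d k w else (ggsA d ^ k).1 w

theorem ggsBFun_ggsBFun (k l : ℤ) (h : k + l = 0) (w : List (Fin d)) :
    ggsBFun d k (ggsBFun d l w) = w := by
  induction w with
  | nil => rfl
  | cons x w ih =>
    by_cases hx : (x : ℕ) + 1 = d
    · simp [ggsBFun, hx, ih]
    · have h1 : (ggsA d ^ k).1 ((ggsA d ^ l).1 w) = (ggsA d ^ k * ggsA d ^ l).1 w := rfl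
      rw [← zpow_add, h, zpow_zero] at h1
      simp only [ggsBFun, hx, if_false]
      rw [h1]
      rfl

/-- The generator `b = (a, …, a, b)`: it fixes the first level, acts as `a` on the first `d - 1`
first-level subtrees and as `b` on the last one. -/
def ggsB (d : ℕ) : TreeAut d :=
  ⟨{ toFun := ggsBFun d 1
     invFun := ggsBFun d (-1)
     left_inv := ggsBFun_ggsBFun _ _ (by norm_num)
     right_inv := ggsBFun_ggsBFun _ _ (by norm_num) },
    by
      intro w
      induction w with
      | nil => rfl
      | cons x w ih =>
        by_cases hx : (x : ℕ) + 1 = d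
        · simpa [ggsBFun, hx] using ih
        · simpa [ggsBFun, hx] using length_apply (ggsA d) w,
    by
      intro u
      induction u with
      | nil => intro v; simp [ggsBFun]
      | cons x u ih =>
        rintro (_ | ⟨y, v⟩)
        · simp [ggsBFun]
        · simp only [Equiv.coe_fn_mk, ggsBFun, List.cons_prefix_cons]
          refine and_congr_right ?_
          rintro rfl
          by_cases hx : (x : ℕ) + 1 = d
          · simpa [hx] using ih v
          · simpa [hx] using prefix_iff (ggsA d) u v⟩

theorem psi_ggsA (d : ℕ) : psi d (ggsA d) = SemidirectProduct.inr (finRotate d) :=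
  (psi d).apply_symm_apply (SemidirectProduct.inr (finRotate d))

theorem psi_ggsB (d : ℕ) :
    psi d (ggsB d) =
      SemidirectProduct.inl fun x : Fin d => if (x : ℕ) + 1 = d then ggsB d else ggsA d := by
  rw [← MulEquiv.eq_symm_apply]
  refine ext_cons fun x w => ?_
  change ggsBFun d 1 (x :: w) = x :: (if (x : ℕ) + 1 = d then ggsB d else ggsA d).1 w
  by_cases hx : (x : ℕ) + 1 = d
  · simp only [ggsBFun, hx, if_true]
    rfl
  · simp only [ggsBFun, hx, if_false, zpow_one]

/-- The GGS-group with constant defining vector on the `d`-regular rooted tree (`d` is an odd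
prime in the usual definition), generated by `a` and `b`. -/
def ggs (d : ℕ) : Subgroup (TreeAut d) :=
  Subgroup.closure {ggsA d, ggsB d}

/-- The normal closure `K` of `b a⁻¹` in the GGS-group. -/
def ggsK (d : ℕ) : Subgroup (TreeAut d) :=
  Subgroup.closure {x | ∃ g ∈ ggs d, x = g * (ggsB d * (ggsA d)⁻¹) * g⁻¹}

end TreeAut

/-! Write `G` for the group, `y₀ = ba⁻¹` and `y₁ = y₀^a` (conjugation `a y₀ a⁻¹`); these two
generate `K`. Everything rests on controlling sections modulo `K'`. Conjugation by `a` induces an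
endomorphism `τ` of `K/K'` with `1 + τ + τ² = 0`, and since `b = y₀a`, conjugation by `b` induces
the same `τ`. Hence a linear condition on the three section classes that is stable under rotation
and under `τ` holds on all of `G'` or `K'` once it holds for one generating commutator. This gives:
sections of `G'` lie in `K` and their classes sum to `0`; sections of `K'` have classes `(z, τz,
τ²z)`.

The three relations. The inclusion `G' ≤ K × K × K` bounds `ψ(G'')` above, and one explicit
commutator of elements of `G'` equal to `([y₀,y₁], 1, 1)` gives the reverse inclusion
(`ggs_derived_eq`). Modulo `K'` the group `G'` is generated by two commuting elements `U`, `V`, so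
`G'' ≤ [K',K]` (`ggs_derived_le`). Finally the first section maps `K'` onto `K`, so commuting `(c,
1, 1)` with elements of `K'` produces `γ₃(K) × 1 × 1` inside `K''` (`branch_ggs_derived_le`).

The congruence property. A finite `3`-group is solvable, and the relations above put an iterated
product `K' × ⋯ × K'` inside each term of the derived series of `G`. It remains to descend along `G
≥ K ≥ K' ≥ K' × K' × K' ≥ ⋯`, one step at a time (`HasThreeCSPModulo.step`): for every `e`, deep
enough elements of one term must be `3^e`-th powers modulo the next. The class in `K/K'` of an
element of `K` fixing level `1` is `1 - τ` applied to a combination of its section classes, so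
fixing level `m` forces the class into the image of `(1 - τ)^m`; and `(1 - τ)² = -3τ`, as for a
primitive cube root of unity. -/

namespace TreeAut

/-! ### Sections, level stabilizers and direct powers `H × ⋯ × H` inside `Aut T` -/

section Sections

variable {d : ℕ}

theorem rootPerm_one : rootPerm (1 : TreeAut d) = 1 := Equiv.ext rootFun_one

theorem rootPerm_mul (g h : TreeAut d) : rootPerm (g * h) = rootPerm g * rootPerm h :=
  Equiv.ext (rootFun_mul g h)

theorem rootPerm_inv (g : TreeAut d) : rootPerm g⁻¹ = (rootPerm g)⁻¹ := by
  rw [eq_inv_iff_mul_eq_one, ← rootPerm_mul, inv_mul_cancel, rootPerm_one]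

theorem sec_one (x : Fin d) : sec (1 : TreeAut d) x = 1 := rfl

theorem sec_mul (g h : TreeAut d) (x : Fin d) :
    sec (g * h) x = sec g (rootPerm h x) * sec h x :=
  Subtype.ext (Equiv.ext (secFun_mul g h x))

theorem sec_inv (g : TreeAut d) (x : Fin d) : sec g⁻¹ x = (sec g ((rootPerm g)⁻¹ x))⁻¹ := by
  have h := sec_mul g⁻¹ g ((rootPerm g)⁻¹ x)
  rw [inv_mul_cancel, sec_one, ← Equiv.Perm.mul_apply, mul_inv_cancel, Equiv.Perm.one_apply] at h
  exact eq_inv_of_mul_eq_one_left h.symm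

theorem ext_sec {g h : TreeAut d} (hr : rootPerm g = rootPerm h)
    (hs : ∀ x, sec g x = sec h x) : g = h :=
  ext_cons fun x w => by rw [apply_cons', apply_cons', hr, hs]

theorem rootPerm_conj {g h : TreeAut d} (hh : rootPerm h = 1) :
    rootPerm (g * h * g⁻¹) = 1 := by
  simp [rootPerm_mul, rootPerm_inv, hh]

theorem sec_conj {g h : TreeAut d} (hh : rootPerm h = 1) (x : Fin d) :
    sec (g * h * g⁻¹) x = sec g ((rootPerm g)⁻¹ x) * sec h ((rootPerm g)⁻¹ x) *
      (sec g ((rootPerm g)⁻¹ x))⁻¹ := by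
  simp [sec_mul, sec_inv, rootPerm_inv, hh]

theorem sec_mul_of_rootPerm (g : TreeAut d) {h : TreeAut d} (hh : rootPerm h = 1) (x : Fin d) :
    sec (g * h) x = sec g x * sec h x := by
  simp [sec_mul, hh]

theorem sec_inv_of_rootPerm {g : TreeAut d} (hg : rootPerm g = 1) (x : Fin d) :
    sec g⁻¹ x = (sec g x)⁻¹ := by
  simp [sec_inv, hg]

theorem rootPerm_pow (g : TreeAut d) (n : ℕ) : rootPerm (g ^ n) = rootPerm g ^ n := by
  induction n with
  | zero => simp [rootPerm_one]
  | succ n ih => rw [pow_succ, rootPerm_mul, ih, pow_succ]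

theorem sec_pow {g : TreeAut d} (hg : rootPerm g = 1) (n : ℕ) (x : Fin d) :
    sec (g ^ n) x = sec g x ^ n := by
  induction n with
  | zero => simp [sec_one]
  | succ n ih => rw [pow_succ, sec_mul_of_rootPerm _ hg, ih, pow_succ]

theorem psi_symm_left (F : Fin d → TreeAut d) :
    rootPerm ((psi d).symm (SemidirectProduct.inl F)) = 1 ∧
      ∀ x, sec ((psi d).symm (SemidirectProduct.inl F)) x = F x := by
  have h := (psi d).apply_symm_apply (SemidirectProduct.inl F)
  have h1 : rootPerm ((psi d).symm (SemidirectProduct.inl F)) = 1 :=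
    congrArg SemidirectProduct.right h
  refine ⟨h1, fun x => ?_⟩
  have h2 := congrFun (congrArg SemidirectProduct.left h) x
  change sec _ ((rootPerm _).symm x) = _ at h2
  rwa [h1] at h2

theorem mem_levelStab_zero (g : TreeAut d) : g ∈ levelStab d 0 := by
  intro w hw
  rw [List.length_eq_zero_iff.1 hw, apply_nil]

theorem mem_levelStab_succ {n : ℕ} {g : TreeAut d} :
    g ∈ levelStab d (n + 1) ↔ rootPerm g = 1 ∧ ∀ x, sec g x ∈ levelStab d n := by
  constructor
  · intro h
    have key : ∀ x w, w.length = n → rootPerm g x = x ∧ (sec g x).1 w = w := fun x w hw => by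
      have := h (x :: w) (by simp [hw])
      rw [apply_cons'] at this
      simpa using this
    exact ⟨Equiv.ext fun x => (key x (List.replicate n x) (by simp)).1,
      fun x w hw => (key x w hw).2⟩
  · rintro ⟨h1, h2⟩ (_ | ⟨x, w⟩) hw
    · simp at hw
    · rw [apply_cons', h1, h2 x w (by simpa using hw)]
      rfl

theorem mem_levelStab_one {g : TreeAut d} : g ∈ levelStab d 1 ↔ rootPerm g = 1 := by
  rw [mem_levelStab_succ]
  exact and_iff_left fun _ => mem_levelStab_zero _

theorem conj_mem_levelStab (n : ℕ) (g : TreeAut d) {h : TreeAut d} (hh : h ∈ levelStab d n) :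
    g * h * g⁻¹ ∈ levelStab d n := by
  intro w hw
  have h1 : h.1 (g⁻¹.1 w) = g⁻¹.1 w := hh _ (by rw [length_apply, hw])
  change g.1 (h.1 (g⁻¹.1 w)) = w
  rw [h1]
  change (g * g⁻¹).1 w = w
  rw [mul_inv_cancel]
  rfl

theorem levelStab_antitone : Antitone (levelStab d) :=
  antitone_nat_of_succ_le fun n => by
    induction n with
    | zero => exact fun g _ => mem_levelStab_zero g
    | succ n ih =>
      intro g hg
      rw [mem_levelStab_succ] at hg ⊢
      exact ⟨hg.1, fun x => ih (hg.2 x)⟩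

/-- The preimage under `ψ` of `H × ⋯ × H`. -/
def branch (H : Subgroup (TreeAut d)) : Subgroup (TreeAut d) :=
  (basePower H).map (psi d).symm.toMonoidHom

theorem mem_branch {H : Subgroup (TreeAut d)} {g : TreeAut d} :
    g ∈ branch H ↔ rootPerm g = 1 ∧ ∀ x, sec g x ∈ H := by
  constructor
  · rintro ⟨_, ⟨F, hF, rfl⟩, rfl⟩
    obtain ⟨h1, h2⟩ := psi_symm_left F
    exact ⟨h1, fun x => (h2 x).symm ▸ hF x (Set.mem_univ _)⟩
  · rintro ⟨h1, h2⟩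
    refine ⟨SemidirectProduct.inl (sec g), ⟨sec g, fun x _ => h2 x, rfl⟩, ?_⟩
    obtain ⟨h3, h4⟩ := psi_symm_left (sec g)
    exact ext_sec (h3.trans h1.symm) h4

theorem map_psi_branch (H : Subgroup (TreeAut d)) :
    (branch H).map (psi d).toMonoidHom = basePower H := by
  rw [branch, Subgroup.map_map]
  convert Subgroup.map_id _
  ext x <;> simp

theorem branch_mono {H L : Subgroup (TreeAut d)} (h : H ≤ L) : branch H ≤ branch L :=
  fun _ hg => mem_branch.2 ⟨(mem_branch.1 hg).1, fun x => h ((mem_branch.1 hg).2 x)⟩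

theorem commutator_branch (H L : Subgroup (TreeAut d)) :
    ⁅branch H, branch L⁆ = branch ⁅H, L⁆ := by
  rw [branch, branch, branch, ← Subgroup.map_commutator, basePower, basePower, basePower,
    ← Subgroup.map_commutator, Subgroup.commutator_pi_pi_of_finite]

/-- Decomposing each section separately carries the power property from `H` to its direct power, at
the cost of one level. This drives the induction along iterated branch subgroups. -/
theorem exists_branch_mul_pow {H R : Subgroup (TreeAut d)} {m q : ℕ}
    (h : ∀ k ∈ H, k ∈ levelStab d m → ∃ t ∈ H, ∃ r ∈ R, k = t ^ q * r) :
    ∀ k ∈ branch H, k ∈ levelStab d (m + 1) →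
      ∃ t ∈ branch H, ∃ r ∈ branch R, k = t ^ q * r := by
  intro k hk hm
  rw [mem_branch] at hk
  rw [mem_levelStab_succ] at hm
  choose t ht r hr htr using fun x => h _ (hk.2 x) (hm.2 x)
  obtain ⟨t1, t2⟩ := psi_symm_left t
  obtain ⟨r1, r2⟩ := psi_symm_left r
  refine ⟨_, mem_branch.2 ⟨t1, fun x => (t2 x).symm ▸ ht x⟩, _,
    mem_branch.2 ⟨r1, fun x => (r2 x).symm ▸ hr x⟩, ext_sec ?_ fun x => ?_⟩
  · rw [rootPerm_mul, rootPerm_pow, t1, r1, hk.1]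
    simp
  · rw [sec_mul_of_rootPerm _ r1, sec_pow t1, t2, r2, htr]

/-- The automorphism with trivial action on the first level, section `g` at `0` and trivial
sections elsewhere. -/
def atZero [NeZero d] : TreeAut d →* TreeAut d :=
  (psi d).symm.toMonoidHom.comp (SemidirectProduct.inl.comp (MonoidHom.mulSingle (fun _ : Fin d => TreeAut d) 0))

theorem rootPerm_atZero [NeZero d] (g : TreeAut d) : rootPerm (atZero g) = 1 :=
  (psi_symm_left _).1

theorem sec_atZero [NeZero d] (g : TreeAut d) (x : Fin d) :
    sec (atZero g) x = if x = 0 then g else 1 := by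
  refine ((psi_symm_left _).2 x).trans ?_
  rw [MonoidHom.mulSingle_apply, Pi.mulSingle_apply]

end Sections

/-! ### Commutator subgroups from generators -/

open scoped commutatorElement in
theorem commutator_closure_le {Γ : Type*} [Group Γ] {s : Set Γ} {E : Subgroup Γ}
    (hE : ∀ g ∈ Subgroup.closure s, ∀ e ∈ E, g * e * g⁻¹ ∈ E)
    (h : ∀ x ∈ s, ∀ y ∈ s, x * y * x⁻¹ * y⁻¹ ∈ E) :
    ⁅Subgroup.closure s, Subgroup.closure s⁆ ≤ E := by
  have key : ∀ y, (∀ x ∈ s, x * y * x⁻¹ * y⁻¹ ∈ E) →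
      ∀ x ∈ Subgroup.closure s, x * y * x⁻¹ * y⁻¹ ∈ E := by
    intro y hy x hx
    induction hx using Subgroup.closure_induction with
    | mem x hx => exact hy x hx
    | one => simp
    | mul x x' hx hx' h1 h2 =>
      convert E.mul_mem (hE x hx _ h2) h1 using 1
      group
    | inv x hx h1 =>
      convert hE x⁻¹ (inv_mem hx) _ (E.inv_mem h1) using 1
      group
  have swap : ∀ x y : Γ, x * y * x⁻¹ * y⁻¹ ∈ E → y * x * y⁻¹ * x⁻¹ ∈ E := by
    intro x y hxy
    convert E.inv_mem hxy using 1
    group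
  rw [Subgroup.commutator_le]
  intro x hx y hy
  exact key y (fun x' hx' => swap _ _ (key x' (fun y' hy' => h y' hy' x' hx') y hy)) x hx

theorem commutator_closure_pair_le {Γ : Type*} [Group Γ] {p q : Γ} {E : Subgroup Γ}
    (hE : ∀ g ∈ Subgroup.closure {p, q}, ∀ e ∈ E, g * e * g⁻¹ ∈ E)
    (h : p * q * p⁻¹ * q⁻¹ ∈ E) :
    ⁅Subgroup.closure {p, q}, Subgroup.closure {p, q}⁆ ≤ E := by
  refine commutator_closure_le hE ?_
  rintro x (rfl | rfl) y (rfl | rfl)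
  · simp
  · exact h
  · convert E.inv_mem h using 1
    group
  · simp

/-! ### Generators of the ternary group -/

theorem rootPerm_ggsA (d : ℕ) : rootPerm (ggsA d) = finRotate d :=
  congrArg SemidirectProduct.right (psi_ggsA d)

theorem sec_ggsA (d : ℕ) (x : Fin d) : sec (ggsA d) x = 1 := by
  have h := congrFun (congrArg SemidirectProduct.left (psi_ggsA d)) (rootPerm (ggsA d) x)
  change sec _ ((rootPerm (ggsA d)).symm _) = 1 at h
  rwa [Equiv.symm_apply_apply] at h

theorem rootPerm_ggsB (d : ℕ) : rootPerm (ggsB d) = 1 :=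
  congrArg SemidirectProduct.right (psi_ggsB d)

theorem sec_ggsB (d : ℕ) (x : Fin d) :
    sec (ggsB d) x = if (x : ℕ) + 1 = d then ggsB d else ggsA d := by
  have h := congrFun (congrArg SemidirectProduct.left (psi_ggsB d)) x
  change sec _ ((rootPerm (ggsB d)).symm _) = _ at h
  rw [rootPerm_ggsB] at h
  exact h

local notation "𝔞" => ggsA 3
local notation "𝔟" => ggsB 3
local notation "𝔊" => ggs 3
local notation "𝔎" => ggsK 3

theorem forall_fin_three {P : Fin 3 → Prop} : (∀ x, P x) ↔ P 0 ∧ P 1 ∧ P 2 :=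
  ⟨fun h => ⟨h 0, h 1, h 2⟩, fun ⟨h0, h1, h2⟩ x => by fin_cases x <;> assumption⟩

theorem ext_three {g h : TreeAut 3} (hr : rootPerm g = rootPerm h) (h0 : sec g 0 = sec h 0)
    (h1 : sec g 1 = sec h 1) (h2 : sec g 2 = sec h 2) : g = h :=
  ext_sec hr (forall_fin_three.2 ⟨h0, h1, h2⟩)

theorem sec_ggsB_zero : sec 𝔟 0 = 𝔞 := by rw [sec_ggsB]; rfl
theorem sec_ggsB_one : sec 𝔟 1 = 𝔞 := by rw [sec_ggsB]; rfl
theorem sec_ggsB_two : sec 𝔟 2 = 𝔟 := by rw [sec_ggsB]; rfl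

theorem sec_conj_ggsA {h : TreeAut 3} (hh : rootPerm h = 1) :
    sec (𝔞 * h * 𝔞⁻¹) 0 = sec h 2 ∧ sec (𝔞 * h * 𝔞⁻¹) 1 = sec h 0 ∧
      sec (𝔞 * h * 𝔞⁻¹) 2 = sec h 1 := by
  have h0 : (finRotate 3)⁻¹ 0 = 2 := by decide
  have h1 : (finRotate 3)⁻¹ 1 = 0 := by decide
  have h2 : (finRotate 3)⁻¹ 2 = 1 := by decide
  simp [sec_conj hh, sec_ggsA, rootPerm_ggsA, h0, h1, h2]

theorem sec_conj_ggsB {h : TreeAut 3} (hh : rootPerm h = 1) :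
    sec (𝔟 * h * 𝔟⁻¹) 0 = 𝔞 * sec h 0 * 𝔞⁻¹ ∧ sec (𝔟 * h * 𝔟⁻¹) 1 = 𝔞 * sec h 1 * 𝔞⁻¹ ∧
      sec (𝔟 * h * 𝔟⁻¹) 2 = 𝔟 * sec h 2 * 𝔟⁻¹ := by
  simp [sec_conj hh, rootPerm_ggsB, sec_ggsB_zero, sec_ggsB_one, sec_ggsB_two]

theorem ggsA_pow_three : 𝔞 ^ 3 = 1 := by
  refine ext_sec ?_ fun x => ?_
  · rw [rootPerm_pow, rootPerm_ggsA, rootPerm_one]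
    decide
  · rw [pow_succ, pow_two, sec_mul, sec_mul, sec_ggsA, sec_ggsA, sec_ggsA, sec_one]
    simp

theorem eq_one_of_forall_mem_levelStab {d : ℕ} {g : TreeAut d} (h : ∀ n, g ∈ levelStab d n) :
    g = 1 :=
  Subtype.ext (Equiv.ext fun w => h w.length w rfl)

/-- The sections of `b³` are `(1, 1, b³)`, so by induction it fixes every level. -/
theorem ggsB_pow_three : 𝔟 ^ 3 = 1 := by
  refine eq_one_of_forall_mem_levelStab fun n => ?_
  induction n with
  | zero => exact mem_levelStab_zero _
  | succ n ih =>
    rw [mem_levelStab_succ, rootPerm_pow, rootPerm_ggsB]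
    refine ⟨one_pow _, forall_fin_three.2 ?_⟩
    simp only [sec_pow (rootPerm_ggsB 3), sec_ggsB_zero, sec_ggsB_one, sec_ggsB_two,
      ggsA_pow_three]
    exact ⟨one_mem _, one_mem _, ih⟩

theorem ggsA_inv : 𝔞⁻¹ = 𝔞 * 𝔞 := by
  rw [inv_eq_iff_mul_eq_one, ← ggsA_pow_three, pow_three]

theorem ggsB_inv : 𝔟⁻¹ = 𝔟 * 𝔟 := by
  rw [inv_eq_iff_mul_eq_one, ← ggsB_pow_three, pow_three]

theorem ggsA_mem : 𝔞 ∈ 𝔊 := Subgroup.subset_closure (by simp)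
theorem ggsB_mem : 𝔟 ∈ 𝔊 := Subgroup.subset_closure (by simp)

theorem ggs_induction {P : TreeAut 3 → Prop} (one : P 1) (mul : ∀ g h, P g → P h → P (g * h))
    (ha : P 𝔞) (hb : P 𝔟) {g : TreeAut 3} (hg : g ∈ 𝔊) : P g := by
  have hPa : P 𝔞⁻¹ := ggsA_inv ▸ mul _ _ ha ha
  have hPb : P 𝔟⁻¹ := ggsB_inv ▸ mul _ _ hb hb
  induction hg using Subgroup.closure_induction'' with
  | mem x hx => rcases hx with rfl | rfl <;> assumption
  | inv_mem x hx => rcases hx with rfl | rfl <;> assumption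
  | one => exact one
  | mul x y _ _ hx hy => exact mul x y hx hy

theorem conj_mem_of_conj_ggsA_ggsB {E : Subgroup (TreeAut 3)}
    (ha : ∀ e ∈ E, 𝔞 * e * 𝔞⁻¹ ∈ E) (hb : ∀ e ∈ E, 𝔟 * e * 𝔟⁻¹ ∈ E) :
    ∀ g ∈ 𝔊, ∀ e ∈ E, g * e * g⁻¹ ∈ E := by
  intro g hg
  refine ggs_induction (P := fun g => ∀ e ∈ E, g * e * g⁻¹ ∈ E) (by simp) ?_ ha hb hg
  intro g h h1 h2 e he
  convert h1 _ (h2 e he) using 1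
  group

/-- The generator `b a⁻¹` of `K`. -/
def ggsY0 : TreeAut 3 := 𝔟 * 𝔞⁻¹

/-- The conjugate of `b a⁻¹` by `a`. -/
def ggsY1 : TreeAut 3 := 𝔞 * ggsY0 * 𝔞⁻¹

/-- The commutator of `b` and `a`, with coordinates `(y₀⁻¹, 1, y₀)`. -/
def ggsU : TreeAut 3 := ggsY0 * ggsY1⁻¹

/-- The conjugate of `ggsU` by `a`, with coordinates `(y₀, y₀⁻¹, 1)`. -/
def ggsV : TreeAut 3 := 𝔞 * ggsU * 𝔞⁻¹

theorem ggsB_eq : 𝔟 = ggsY0 * 𝔞 := by simp [ggsY0]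

theorem conj_ggsY0 : 𝔞 * ggsY0 * 𝔞⁻¹ = ggsY1 := rfl

/-- With `y₂` the next conjugate, `y₂y₀y₁ = a²b³a⁻²` because `a³ = 1`, and `b³ = 1`. This is the
source of `1 + τ + τ² = 0` on `K/K'`. -/
theorem conj_ggsY1 : 𝔞 * ggsY1 * 𝔞⁻¹ = ggsY1⁻¹ * ggsY0⁻¹ := by
  have ha : 𝔞 * (𝔞 * 𝔞) = 1 := by rw [← ggsA_pow_three, pow_three]
  have ha' : ∀ x, 𝔞 * (𝔞 * (𝔞 * x)) = x := fun x => by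
    rw [← mul_assoc, ← mul_assoc, ← pow_three', ggsA_pow_three, one_mul]
  have hb' : ∀ x, 𝔟 * (𝔟 * (𝔟 * x)) = x := fun x => by
    rw [← mul_assoc, ← mul_assoc, ← pow_three', ggsB_pow_three, one_mul]
  rw [← mul_inv_rev, eq_inv_iff_mul_eq_one, ggsY1, ggsY0, ggsA_inv]
  simp only [mul_assoc, ha, ha', hb', mul_one]

theorem conj_mul' {Γ : Type*} [Group Γ] (g x y : Γ) :
    g * (x * y) * g⁻¹ = (g * x * g⁻¹) * (g * y * g⁻¹) := by group

theorem conj_inv' {Γ : Type*} [Group Γ] (g x : Γ) :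
    g * x⁻¹ * g⁻¹ = (g * x * g⁻¹)⁻¹ := by group

theorem ggsU_eq : ggsU = 𝔟 * 𝔞 * 𝔟⁻¹ * 𝔞⁻¹ := by
  rw [ggsU, ggsY1, ggsY0]; group

theorem ggsV_eq : ggsV = ggsY1 * ggsY0 * ggsY1 := by
  rw [ggsV, ggsU, conj_mul', conj_inv', conj_ggsY0, conj_ggsY1]; group

theorem conj_ggsV : 𝔞 * ggsV * 𝔞⁻¹ = ggsV⁻¹ * ggsU⁻¹ := by
  rw [ggsV_eq, conj_mul', conj_mul', conj_ggsY0, conj_ggsY1, ggsU]; group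

theorem rootPerm_ggsU : rootPerm ggsU = 1 := by
  simp [ggsU_eq, rootPerm_mul, rootPerm_inv, rootPerm_ggsB]

theorem rootPerm_ggsV : rootPerm ggsV = 1 := rootPerm_conj rootPerm_ggsU

theorem ggsU_eq' : ggsU = 𝔟 * (𝔞 * 𝔟⁻¹ * 𝔞⁻¹) := by
  rw [ggsU_eq]; group

theorem sec_ggsU : sec ggsU 0 = ggsY0⁻¹ ∧ sec ggsU 1 = 1 ∧ sec ggsU 2 = ggsY0 := by
  have hb : rootPerm 𝔟⁻¹ = 1 := by rw [rootPerm_inv, rootPerm_ggsB, inv_one]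
  obtain ⟨h0, h1, h2⟩ := sec_conj_ggsA hb
  rw [ggsU_eq']
  simp only [sec_mul_of_rootPerm _ (rootPerm_conj hb), h0, h1, h2,
    sec_inv_of_rootPerm (rootPerm_ggsB 3), sec_ggsB_zero, sec_ggsB_one, sec_ggsB_two, ggsY0]
  simp

theorem sec_ggsV : sec ggsV 0 = ggsY0 ∧ sec ggsV 1 = ggsY0⁻¹ ∧ sec ggsV 2 = 1 := by
  obtain ⟨h0, h1, h2⟩ := sec_conj_ggsA rootPerm_ggsU
  obtain ⟨h3, h4, h5⟩ := sec_ggsU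
  exact ⟨h0.trans h5, h1.trans h3, h2.trans h4⟩

/-- In every coordinate both elements are powers of the single element `y₀`. -/
theorem ggsU_mul_ggsV : ggsU * ggsV = ggsV * ggsU := by
  have h1 := sec_ggsU
  have h2 := sec_ggsV
  refine ext_three ?_ ?_ ?_ ?_ <;>
    simp [rootPerm_mul, rootPerm_ggsU, rootPerm_ggsV, sec_mul_of_rootPerm, h1, h2]

/-! ### The subgroup `K` -/

theorem ggsK_eq_closure : 𝔎 = Subgroup.closure {ggsY0, ggsY1} := by
  have h0 : ggsY0 ∈ Subgroup.closure {ggsY0, ggsY1} := Subgroup.subset_closure (by simp)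
  have h1 : ggsY1 ∈ Subgroup.closure {ggsY0, ggsY1} := Subgroup.subset_closure (by simp)
  apply le_antisymm
  · have ha : ∀ e ∈ Subgroup.closure {ggsY0, ggsY1},
        𝔞 * e * 𝔞⁻¹ ∈ Subgroup.closure {ggsY0, ggsY1} := by
      intro e he
      induction he using Subgroup.closure_induction with
      | mem x hx =>
        rcases hx with rfl | rfl
        · exact h1
        · rw [conj_ggsY1]
          exact mul_mem (inv_mem h1) (inv_mem h0)
      | one => simp
      | mul x y _ _ hx hy => rw [conj_mul']; exact mul_mem hx hy
      | inv x _ hx => rw [conj_inv']; exact inv_mem hx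
    have hb : ∀ e ∈ Subgroup.closure {ggsY0, ggsY1},
        𝔟 * e * 𝔟⁻¹ ∈ Subgroup.closure {ggsY0, ggsY1} := by
      intro e he
      -- Since `b = y₀a`, invariance under `b` follows from invariance under `a`.
      have h : 𝔟 * e * 𝔟⁻¹ = ggsY0 * (𝔞 * e * 𝔞⁻¹) * ggsY0⁻¹ := by rw [ggsB_eq]; group
      rw [h]
      exact mul_mem (mul_mem h0 (ha e he)) (inv_mem h0)
    rw [ggsK, Subgroup.closure_le]
    rintro _ ⟨g, hg, rfl⟩
    exact conj_mem_of_conj_ggsA_ggsB ha hb g hg _ h0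
  · rw [Subgroup.closure_le]
    rintro _ (rfl | rfl)
    · exact Subgroup.subset_closure ⟨1, one_mem _, by simp [ggsY0]⟩
    · exact Subgroup.subset_closure ⟨𝔞, ggsA_mem, rfl⟩

theorem ggsY0_mem : ggsY0 ∈ 𝔎 := ggsK_eq_closure ▸ Subgroup.subset_closure (by simp)
theorem ggsY1_mem : ggsY1 ∈ 𝔎 := ggsK_eq_closure ▸ Subgroup.subset_closure (by simp)

theorem ggsK_le : 𝔎 ≤ 𝔊 := by
  rw [ggsK, Subgroup.closure_le]
  rintro _ ⟨g, hg, rfl⟩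
  exact mul_mem (mul_mem hg (mul_mem ggsB_mem (inv_mem ggsA_mem))) (inv_mem hg)

theorem ggsK_induction {P : TreeAut 3 → Prop} (one : P 1) (mul : ∀ g h, P g → P h → P (g * h))
    (inv : ∀ g, P g → P g⁻¹) (h0 : P ggsY0) (h1 : P ggsY1) {g : TreeAut 3} (hg : g ∈ 𝔎) :
    P g := by
  rw [ggsK_eq_closure] at hg
  induction hg using Subgroup.closure_induction with
  | mem x hx => rcases hx with rfl | rfl <;> assumption
  | one => exact one
  | mul x y _ _ hx hy => exact mul x y hx hy
  | inv x _ hx => exact inv x hx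

/-- `H` is normalized by the group generated by `a` and `b`. -/
def GgsInvariant (H : Subgroup (TreeAut 3)) : Prop :=
  ∀ g ∈ 𝔊, ∀ h ∈ H, g * h * g⁻¹ ∈ H

theorem GgsInvariant.commutator {H L : Subgroup (TreeAut 3)} (hH : GgsInvariant H)
    (hL : GgsInvariant L) : GgsInvariant ⁅H, L⁆ := by
  intro g hg
  have h : ⁅H, L⁆ ≤ ⁅H, L⁆.comap (MulAut.conj g).toMonoidHom := by
    rw [Subgroup.commutator_le]
    intro x hx y hy
    rw [Subgroup.mem_comap, map_commutatorElement]
    exact Subgroup.commutator_mem_commutator (hH g hg x hx) (hL g hg y hy)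
  exact fun x hx => h hx

theorem ggsInvariant_ggs : GgsInvariant 𝔊 :=
  fun _ hg _ hh => mul_mem (mul_mem hg hh) (inv_mem hg)

theorem ggsInvariant_ggsK : GgsInvariant 𝔎 := by
  intro g hg h hh
  refine ggsK_induction (P := fun h => g * h * g⁻¹ ∈ 𝔎) (by simp) ?_ ?_ ?_ ?_ hh
  · intro x y hx hy; rw [conj_mul']; exact mul_mem hx hy
  · intro x hx; rw [conj_inv']; exact inv_mem hx
  · exact Subgroup.subset_closure ⟨g, hg, rfl⟩
  · refine Subgroup.subset_closure ⟨g * 𝔞, mul_mem hg ggsA_mem, ?_⟩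
    rw [ggsY1, ggsY0]; group

theorem rootPerm_mem_zpowers {g : TreeAut 3} (hg : g ∈ 𝔊) :
    rootPerm g ∈ Subgroup.zpowers (finRotate 3) := by
  refine ggs_induction (P := fun g => rootPerm g ∈ Subgroup.zpowers (finRotate 3)) ?_ ?_ ?_ ?_ hg
  · rw [rootPerm_one]; exact one_mem _
  · intro g h hg hh; rw [rootPerm_mul]; exact mul_mem hg hh
  · rw [rootPerm_ggsA]; exact Subgroup.mem_zpowers _
  · rw [rootPerm_ggsB]; exact one_mem _

theorem sec_mem_ggs {g : TreeAut 3} (hg : g ∈ 𝔊) (x : Fin 3) : sec g x ∈ 𝔊 := by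
  refine ggs_induction (P := fun g => ∀ x, sec g x ∈ 𝔊) ?_ ?_ ?_ ?_ hg x
  · exact fun x => one_mem _
  · intro g h hg hh x; rw [sec_mul]; exact mul_mem (hg _) (hh _)
  · intro x; rw [sec_ggsA]; exact one_mem _
  · intro x; rw [sec_ggsB]; split_ifs
    exacts [ggsB_mem, ggsA_mem]

theorem GgsInvariant.branch {H : Subgroup (TreeAut 3)} (hH : GgsInvariant H) :
    GgsInvariant (branch H) := by
  intro g hg h hh
  rw [mem_branch] at hh ⊢
  refine ⟨rootPerm_conj hh.1, fun x => ?_⟩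
  rw [sec_conj hh.1]
  exact hH _ (sec_mem_ggs hg _) _ (hh.2 _)

/-- The action on the first level is through the cyclic group generated by the rotation. -/
theorem commutator_le_levelStab_one : ⁅𝔊, 𝔊⁆ ≤ levelStab 3 1 := by
  rw [Subgroup.commutator_le]
  intro g hg h hh
  obtain ⟨i, hi⟩ := rootPerm_mem_zpowers hg
  obtain ⟨j, hj⟩ := rootPerm_mem_zpowers hh
  simp only at hi hj
  rw [mem_levelStab_one]
  simp only [commutatorElement_def, rootPerm_mul, rootPerm_inv, ← hi, ← hj]
  rw [← zpow_add, ← zpow_neg, ← zpow_add, ← zpow_neg, ← zpow_add]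
  simp

/-! ### Abelianizations of subgroups -/

section AbClass

variable {Γ : Type*} [Group Γ]

open Classical in
/-- The class of `g` in the abelianization of the subgroup `H`, with value `0` outside `H`. -/
noncomputable def abClass (H : Subgroup Γ) (g : Γ) : Additive (Abelianization H) :=
  if h : g ∈ H then Additive.ofMul (Abelianization.of ⟨g, h⟩) else 0

variable {H : Subgroup Γ} {g h : Γ}

theorem abClass_of_mem (hg : g ∈ H) :
    abClass H g = Additive.ofMul (Abelianization.of ⟨g, hg⟩) := dif_pos hg

theorem abClass_one : abClass H 1 = 0 := by
  rw [abClass_of_mem (one_mem H)]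
  exact congrArg Additive.ofMul (map_one Abelianization.of)

theorem abClass_mul (hg : g ∈ H) (hh : h ∈ H) :
    abClass H (g * h) = abClass H g + abClass H h := by
  rw [abClass_of_mem hg, abClass_of_mem hh, abClass_of_mem (mul_mem hg hh), ← ofMul_mul, ← map_mul]
  rfl

theorem abClass_inv (hg : g ∈ H) : abClass H g⁻¹ = -abClass H g := by
  rw [eq_neg_iff_add_eq_zero, ← abClass_mul (inv_mem hg) hg, inv_mul_cancel, abClass_one]

theorem abClass_zpow (hg : g ∈ H) (n : ℤ) : abClass H (g ^ n) = n • abClass H g := by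
  rw [abClass_of_mem hg, abClass_of_mem (zpow_mem hg n), ← ofMul_zpow, ← map_zpow]
  rfl

theorem abClass_pow (hg : g ∈ H) (n : ℕ) : abClass H (g ^ n) = n • abClass H g := by
  rw [← zpow_natCast, abClass_zpow hg, natCast_zsmul]

theorem abClass_eq_zero_iff (hg : g ∈ H) : abClass H g = 0 ↔ g ∈ ⁅H, H⁆ := by
  rw [abClass_of_mem hg, ofMul_eq_zero, ← MonoidHom.mem_ker, Abelianization.ker_of,
    ← Subgroup.map_subtype_commutator, Subgroup.mem_map]
  constructor
  · exact fun h => ⟨_, h, rfl⟩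
  · rintro ⟨⟨x, hx⟩, hx', rfl⟩
    exact hx'

theorem exists_abClass_eq (z : Additive (Abelianization H)) : ∃ g ∈ H, abClass H g = z := by
  obtain ⟨⟨g, hg⟩, hz⟩ := QuotientGroup.mk_surjective (s := commutator H) z.toMul
  exact ⟨g, hg, (abClass_of_mem hg).trans hz⟩

theorem exists_eq_mul_of_abClass_eq (hg : g ∈ H) (hh : h ∈ H) (e : abClass H g = abClass H h) :
    ∃ c ∈ ⁅H, H⁆, g = h * c := by
  refine ⟨h⁻¹ * g, ?_, by group⟩
  rw [← abClass_eq_zero_iff (mul_mem (inv_mem hh) hg), abClass_mul (inv_mem hh) hg,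
    abClass_inv hh, e, neg_add_cancel]

end AbClass

/-! ### The endomorphism `τ` of `K/K'` and linear conditions on section classes -/

/-- The endomorphism of `K / K'` induced by conjugation by `a`. -/
noncomputable def ggsTau : AddMonoid.End (Additive (Abelianization 𝔎)) :=
  (Abelianization.map (((MulAut.conj 𝔞).toMonoidHom.comp (𝔎).subtype).codRestrict 𝔎
    fun k => ggsInvariant_ggsK _ ggsA_mem _ k.2)).toAdditive

theorem conj_ggsA_mem_ggsK {x : TreeAut 3} (hx : x ∈ 𝔎) : 𝔞 * x * 𝔞⁻¹ ∈ 𝔎 :=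
  ggsInvariant_ggsK _ ggsA_mem _ hx

theorem abClass_conj_ggsA {x : TreeAut 3} (hx : x ∈ 𝔎) :
    abClass 𝔎 (𝔞 * x * 𝔞⁻¹) = ggsTau (abClass 𝔎 x) := by
  rw [abClass_of_mem hx, abClass_of_mem (conj_ggsA_mem_ggsK hx)]
  rfl

theorem abClass_conj_ggsB {x : TreeAut 3} (hx : x ∈ 𝔎) :
    abClass 𝔎 (𝔟 * x * 𝔟⁻¹) = ggsTau (abClass 𝔎 x) := by
  have h : 𝔟 * x * 𝔟⁻¹ = ggsY0 * (𝔞 * x * 𝔞⁻¹) * ggsY0⁻¹ := by rw [ggsB_eq]; group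
  have hx' := conj_ggsA_mem_ggsK hx
  rw [h, abClass_mul (mul_mem ggsY0_mem hx') (inv_mem ggsY0_mem), abClass_mul ggsY0_mem hx',
    abClass_inv ggsY0_mem, abClass_conj_ggsA hx, add_neg_cancel_comm]

theorem add_ggsTau_add_ggsTau (z : Additive (Abelianization 𝔎)) :
    z + ggsTau z + ggsTau (ggsTau z) = 0 := by
  obtain ⟨x, hx, rfl⟩ := exists_abClass_eq z
  have h1 : ggsTau (abClass 𝔎 ggsY0) = abClass 𝔎 ggsY1 := (abClass_conj_ggsA ggsY0_mem).symm
  have h2 : ggsTau (abClass 𝔎 ggsY1) = - abClass 𝔎 ggsY1 - abClass 𝔎 ggsY0 := by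
    rw [← abClass_conj_ggsA ggsY1_mem, conj_ggsY1,
      abClass_mul (inv_mem ggsY1_mem) (inv_mem ggsY0_mem), abClass_inv ggsY1_mem,
      abClass_inv ggsY0_mem, sub_eq_add_neg]
  refine (ggsK_induction (P := fun x => x ∈ 𝔎 ∧ abClass 𝔎 x + ggsTau (abClass 𝔎 x) +
    ggsTau (ggsTau (abClass 𝔎 x)) = 0) ?_ ?_ ?_ ?_ ?_ hx).2
  · exact ⟨one_mem _, by simp [abClass_one]⟩
  · rintro g h ⟨hg, hg'⟩ ⟨hh, hh'⟩
    refine ⟨mul_mem hg hh, ?_⟩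
    rw [abClass_mul hg hh, map_add, map_add, ← add_zero (0 : Additive (Abelianization 𝔎))]
    nth_rewrite 1 [← hg']
    rw [← hh']
    abel
  · rintro g ⟨hg, hg'⟩
    refine ⟨inv_mem hg, ?_⟩
    rw [abClass_inv hg, map_neg, map_neg, ← neg_zero, ← hg']
    abel
  · refine ⟨ggsY0_mem, ?_⟩
    rw [h1, h2]; abel
  · refine ⟨ggsY1_mem, ?_⟩
    rw [h2, map_sub, map_neg, h2, h1]; abel

theorem ggsTau_relation : 1 + ggsTau + ggsTau * ggsTau = 0 :=
  AddMonoidHom.ext fun z => add_ggsTau_add_ggsTau z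

/-- The elements of `K × K × K` whose classes modulo `K' × K' × K'` lie in `M`. -/
def sectionSubgroup (M : AddSubgroup (Fin 3 → Additive (Abelianization 𝔎))) :
    Subgroup (TreeAut 3) where
  carrier := {g | g ∈ branch 𝔎 ∧ (fun x => abClass 𝔎 (sec g x)) ∈ M}
  one_mem' := ⟨one_mem _, by
    simp only [sec_one, abClass_one]
    exact M.zero_mem⟩
  mul_mem' := by
    rintro g h ⟨hg, hg'⟩ ⟨hh, hh'⟩
    refine ⟨mul_mem hg hh, ?_⟩
    convert M.add_mem hg' hh' using 1
    rw [mem_branch] at hg hh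
    funext x
    rw [sec_mul_of_rootPerm _ hh.1, abClass_mul (hg.2 x) (hh.2 x)]
    rfl
  inv_mem' := by
    rintro g ⟨hg, hg'⟩
    refine ⟨inv_mem hg, ?_⟩
    convert M.neg_mem hg' using 1
    rw [mem_branch] at hg
    funext x
    rw [sec_inv_of_rootPerm hg.1, abClass_inv (hg.2 x)]
    rfl

/-- On triples of classes, conjugation by `a` rotates the coordinates, while conjugation by `b = (a,
a, b)` applies `τ` to each of them. -/
theorem ggsInvariant_sectionSubgroup {M : AddSubgroup (Fin 3 → Additive (Abelianization 𝔎))}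
    (hrot : ∀ f ∈ M, ![f 2, f 0, f 1] ∈ M) (htau : ∀ f ∈ M, (fun x => ggsTau (f x)) ∈ M) :
    GgsInvariant (sectionSubgroup M) := by
  apply conj_mem_of_conj_ggsA_ggsB
  · rintro g ⟨hg, hg'⟩
    refine ⟨ggsInvariant_ggsK.branch _ ggsA_mem _ hg, ?_⟩
    obtain ⟨h0, h1, h2⟩ := sec_conj_ggsA (mem_branch.1 hg).1
    convert hrot _ hg' using 1
    funext x
    revert x
    rw [forall_fin_three, h0, h1, h2]
    exact ⟨rfl, rfl, rfl⟩
  · rintro g ⟨hg, hg'⟩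
    refine ⟨ggsInvariant_ggsK.branch _ ggsB_mem _ hg, ?_⟩
    rw [mem_branch] at hg
    obtain ⟨h0, h1, h2⟩ := sec_conj_ggsB hg.1
    convert htau _ hg' using 1
    funext x
    revert x
    rw [forall_fin_three, h0, h1, h2]
    exact ⟨abClass_conj_ggsA (hg.2 0), abClass_conj_ggsA (hg.2 1), abClass_conj_ggsB (hg.2 2)⟩

theorem ggsU_mem_commutator : ggsU ∈ ⁅𝔊, 𝔊⁆ := by
  rw [ggsU_eq]
  exact Subgroup.commutator_mem_commutator ggsB_mem ggsA_mem

theorem ggs_commutator_le {E : Subgroup (TreeAut 3)} (hE : GgsInvariant E) (h : ggsU ∈ E) :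
    ⁅𝔊, 𝔊⁆ ≤ E := by
  refine commutator_closure_pair_le hE ?_
  convert E.inv_mem h using 1
  rw [ggsU_eq]; group

theorem ggsK_commutator_le {E : Subgroup (TreeAut 3)} (hE : GgsInvariant E)
    (h : ggsY0 * ggsY1 * ggsY0⁻¹ * ggsY1⁻¹ ∈ E) : ⁅𝔎, 𝔎⁆ ≤ E := by
  have h' := commutator_closure_pair_le
    (fun g hg => hE g (ggsK_le (ggsK_eq_closure ▸ hg))) h
  rwa [← ggsK_eq_closure] at h'

theorem ggsU_mem_ggsK : ggsU ∈ 𝔎 := mul_mem ggsY0_mem (inv_mem ggsY1_mem)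

theorem ggs_commutator_le_ggsK : ⁅𝔊, 𝔊⁆ ≤ 𝔎 :=
  ggs_commutator_le ggsInvariant_ggsK ggsU_mem_ggsK

/-- The zero-sum condition is stable under rotation and `τ`, and `U = (y₀⁻¹, 1, y₀)`, whose
conjugates generate `G'`, satisfies it. -/
theorem ggs_commutator_sections {g : TreeAut 3} (hg : g ∈ ⁅𝔊, 𝔊⁆) :
    rootPerm g = 1 ∧ (∀ x, sec g x ∈ 𝔎) ∧
      abClass 𝔎 (sec g 0) + abClass 𝔎 (sec g 1) + abClass 𝔎 (sec g 2) = 0 := by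
  let M : AddSubgroup (Fin 3 → Additive (Abelianization 𝔎)) :=
    { carrier := {f | f 0 + f 1 + f 2 = 0}
      zero_mem' := by simp
      add_mem' := by
        intro f f' hf hf'
        have h : f 0 + f 1 + f 2 + (f' 0 + f' 1 + f' 2) = 0 := by rw [hf, hf', add_zero]
        rw [Set.mem_ofPred_eq, ← h]
        simp only [Pi.add_apply]
        abel
      neg_mem' := by
        intro f hf
        have h : -(f 0 + f 1 + f 2) = 0 := by rw [hf, neg_zero]
        rw [Set.mem_ofPred_eq, ← h]
        simp only [Pi.neg_apply]
        abel }
  have hM : GgsInvariant (sectionSubgroup M) := by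
    apply ggsInvariant_sectionSubgroup
    · intro f hf
      change f 2 + f 0 + f 1 = 0
      rw [← show f 0 + f 1 + f 2 = 0 from hf]; abel
    · intro f hf
      change ggsTau _ + ggsTau _ + ggsTau _ = 0
      rw [← map_add, ← map_add, show f 0 + f 1 + f 2 = 0 from hf, map_zero]
  have hU : ggsU ∈ sectionSubgroup M := by
    obtain ⟨h0, h1, h2⟩ := sec_ggsU
    refine ⟨mem_branch.2 ⟨rootPerm_ggsU, forall_fin_three.2 ?_⟩, ?_⟩
    · rw [h0, h1, h2]
      exact ⟨inv_mem ggsY0_mem, one_mem _, ggsY0_mem⟩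
    · change abClass 𝔎 _ + abClass 𝔎 _ + abClass 𝔎 _ = 0
      rw [h0, h1, h2, abClass_inv ggsY0_mem, abClass_one]
      abel
  obtain ⟨h1, h2⟩ := ggs_commutator_le hM hU hg
  exact ⟨(mem_branch.1 h1).1, (mem_branch.1 h1).2, h2⟩

/-! ### Relations between the derived series of the group and of `K` -/

/-- Conjugation by `a` moves the factor at `0` to the other two, so one coordinate suffices. -/
theorem branch_le_of_atZero {H E : Subgroup (TreeAut 3)} (hE : GgsInvariant E)
    (h : ∀ x ∈ H, atZero x ∈ E) : branch H ≤ E := by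
  intro g hg
  rw [mem_branch] at hg
  have e : g = atZero (sec g 0) * (𝔞 * atZero (sec g 1) * 𝔞⁻¹) *
      (𝔞 * (𝔞 * atZero (sec g 2) * 𝔞⁻¹) * 𝔞⁻¹) := by
    have r : ∀ x, rootPerm (𝔞 * atZero x * 𝔞⁻¹) = 1 := fun x => rootPerm_conj (rootPerm_atZero x)
    have r' : ∀ x, rootPerm (𝔞 * (𝔞 * atZero x * 𝔞⁻¹) * 𝔞⁻¹) = 1 := fun x => rootPerm_conj (r x)
    have s := fun x => sec_conj_ggsA (rootPerm_atZero (d := 3) x)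
    have s' := fun x => sec_conj_ggsA (r x)
    refine ext_three ?_ ?_ ?_ ?_
    · rw [rootPerm_mul, rootPerm_mul, r, r', rootPerm_atZero, hg.1]; simp
    all_goals
      rw [sec_mul_of_rootPerm _ (r' _), sec_mul_of_rootPerm _ (r _)]
      simp [s, s', sec_atZero]
  rw [e]
  have ha := hE _ ggsA_mem
  exact mul_mem (mul_mem (h _ (hg.2 0)) (ha _ (h _ (hg.2 1)))) (ha _ (ha _ (h _ (hg.2 2))))

theorem atZero_conj_sec {g x : TreeAut 3} (hg : rootPerm g = 1) :
    atZero (sec g 0 * x * (sec g 0)⁻¹) = g * atZero x * g⁻¹ := by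
  refine ext_sec ?_ fun i => ?_
  · rw [rootPerm_atZero, rootPerm_conj (rootPerm_atZero x)]
  · rw [sec_conj (rootPerm_atZero x), sec_atZero, sec_atZero, hg, inv_one, Equiv.Perm.one_apply]
    split_ifs with h
    · rw [h]
    · simp

theorem exists_sec_zero_eq {g : TreeAut 3} (hg : g ∈ 𝔊) :
    ∃ s ∈ 𝔊, rootPerm s = 1 ∧ sec s 0 = g := by
  refine ggs_induction (P := fun g => ∃ s ∈ 𝔊, rootPerm s = 1 ∧ sec s 0 = g) ?_ ?_ ?_ ?_ hg
  · exact ⟨1, one_mem _, rootPerm_one, rfl⟩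
  · rintro g h ⟨s, hs, hs1, rfl⟩ ⟨t, ht, ht1, rfl⟩
    exact ⟨s * t, mul_mem hs ht, by simp [rootPerm_mul, hs1, ht1], sec_mul_of_rootPerm _ ht1 _⟩
  · exact ⟨𝔟, ggsB_mem, rootPerm_ggsB 3, sec_ggsB_zero⟩
  · exact ⟨𝔞 * 𝔟 * 𝔞⁻¹, ggsInvariant_ggs _ ggsA_mem _ ggsB_mem, rootPerm_conj (rootPerm_ggsB 3),
      (sec_conj_ggsA (rootPerm_ggsB 3)).1.trans sec_ggsB_two⟩

/-- Each element of `G` is the section at `0` of an element of `G` fixing the first level, so any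
conjugation in that coordinate is realized inside `G`. -/
theorem GgsInvariant.comap_atZero {E : Subgroup (TreeAut 3)} (hE : GgsInvariant E) :
    GgsInvariant (E.comap atZero) := by
  intro g hg x hx
  obtain ⟨s, hs, hs1, rfl⟩ := exists_sec_zero_eq hg
  rw [Subgroup.mem_comap, atZero_conj_sec hs1]
  exact hE s hs _ hx

theorem ggsInvariant_ggs_derived : GgsInvariant ⁅⁅𝔊, 𝔊⁆, ⁅𝔊, 𝔊⁆⁆ :=
  (ggsInvariant_ggs.commutator ggsInvariant_ggs).commutator
    (ggsInvariant_ggs.commutator ggsInvariant_ggs)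

theorem ggs_derived_eq : ⁅⁅𝔊, 𝔊⁆, ⁅𝔊, 𝔊⁆⁆ = branch ⁅𝔎, 𝔎⁆ := by
  apply le_antisymm
  · rw [← commutator_branch]
    have h : ⁅𝔊, 𝔊⁆ ≤ branch 𝔎 := fun g hg =>
      mem_branch.2 ⟨(ggs_commutator_sections hg).1, (ggs_commutator_sections hg).2.1⟩
    exact Subgroup.commutator_mono h h
  · refine branch_le_of_atZero ggsInvariant_ggs_derived
      (ggsK_commutator_le ggsInvariant_ggs_derived.comap_atZero ?_)
    have hc := ggsInvariant_ggs.commutator ggsInvariant_ggs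
    have hU := ggsU_mem_commutator
    -- `U⁻¹ = (y₀, 1, y₀⁻¹)` and `bVb⁻¹ = (y₁, y₁⁻¹, 1)` overlap nontrivially only in coordinate
    -- `0`.
    have e : atZero (ggsY0 * ggsY1 * ggsY0⁻¹ * ggsY1⁻¹) =
        ggsU⁻¹ * (𝔟 * ggsV * 𝔟⁻¹) * ggsU⁻¹⁻¹ * (𝔟 * ggsV * 𝔟⁻¹)⁻¹ := by
      have r := rootPerm_conj (g := 𝔟) rootPerm_ggsV
      have s := sec_conj_ggsB rootPerm_ggsV
      refine ext_three ?_ ?_ ?_ ?_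
      · simp [rootPerm_mul, rootPerm_inv, rootPerm_atZero, rootPerm_ggsU, rootPerm_ggsV]
      all_goals
        rw [sec_atZero, inv_inv, sec_mul_of_rootPerm _ (by rw [rootPerm_inv, r, inv_one]),
          sec_mul_of_rootPerm _ rootPerm_ggsU, sec_mul_of_rootPerm _ r,
          sec_inv_of_rootPerm rootPerm_ggsU, sec_inv_of_rootPerm r]
        simp only [s, sec_ggsU, sec_ggsV]
        simp [ggsY1, mul_assoc]
    rw [Subgroup.mem_comap, e]
    exact Subgroup.commutator_mem_commutator (inv_mem hU) (hc _ ggsB_mem _ (hc _ ggsA_mem _ hU))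

theorem ggs_derived_le : ⁅⁅𝔊, 𝔊⁆, ⁅𝔊, 𝔊⁆⁆ ≤ ⁅⁅𝔎, 𝔎⁆, 𝔎⁆ := by
  have hV : ggsV ∈ 𝔎 := conj_ggsA_mem_ggsK ggsU_mem_ggsK
  have hinv : GgsInvariant ⁅⁅𝔎, 𝔎⁆, 𝔎⁆ :=
    (ggsInvariant_ggsK.commutator ggsInvariant_ggsK).commutator ggsInvariant_ggsK
  set s : Set (TreeAut 3) := {ggsU, ggsV} ∪ (⁅𝔎, 𝔎⁆ : Subgroup (TreeAut 3)) with hs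
  have hUs : ggsU ∈ Subgroup.closure s := Subgroup.subset_closure (by simp [hs])
  have hVs : ggsV ∈ Subgroup.closure s := Subgroup.subset_closure (by simp [hs])
  have hKs : ⁅𝔎, 𝔎⁆ ≤ Subgroup.closure s := fun x hx => Subgroup.subset_closure (Or.inr hx)
  have hsK : Subgroup.closure s ≤ 𝔎 := by
    rw [Subgroup.closure_le]
    rintro x ((rfl | rfl) | hx)
    exacts [ggsU_mem_ggsK, hV, Subgroup.commutator_le_self _ hx]
  have hconj : ∀ y ∈ 𝔎, ∀ x ∈ Subgroup.closure s, y * x * y⁻¹ ∈ Subgroup.closure s := by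
    intro y hy x hx
    have e : y * x * y⁻¹ = (y * x * y⁻¹ * x⁻¹) * x := by group
    rw [e]
    exact mul_mem (hKs (Subgroup.commutator_mem_commutator hy (hsK hx))) hx
  have hsa : ∀ e ∈ Subgroup.closure s, 𝔞 * e * 𝔞⁻¹ ∈ Subgroup.closure s := by
    intro e he
    induction he using Subgroup.closure_induction with
    | mem x hx =>
      rcases hx with (rfl | rfl) | hx
      · exact hVs
      · rw [conj_ggsV]
        exact mul_mem (inv_mem hVs) (inv_mem hUs)
      · exact hKs ((ggsInvariant_ggsK.commutator ggsInvariant_ggsK) _ ggsA_mem _ hx)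
    | one => simp
    | mul x y _ _ hx hy => rw [conj_mul']; exact mul_mem hx hy
    | inv x _ hx => rw [conj_inv']; exact inv_mem hx
  have hsinv : GgsInvariant (Subgroup.closure s) := by
    refine conj_mem_of_conj_ggsA_ggsB hsa fun e he => ?_
    have h : 𝔟 * e * 𝔟⁻¹ = ggsY0 * (𝔞 * e * 𝔞⁻¹) * ggsY0⁻¹ := by rw [ggsB_eq]; group
    rw [h]
    exact hconj _ ggsY0_mem _ (hsa e he)
  -- Now `G'` lies in the subgroup generated by `U`, `V` and `K'`. Commutators of these generators
  -- lie in `γ₃(K)`: `U` and `V` commute, and any other pair involves `K'`.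
  have hle := ggs_commutator_le hsinv hUs
  refine (Subgroup.commutator_mono hle hle).trans
    (commutator_closure_le (fun g hg => hinv g (ggsK_le (hsK hg))) ?_)
  have hleft : ∀ x ∈ ⁅𝔎, 𝔎⁆, ∀ y ∈ 𝔎, x * y * x⁻¹ * y⁻¹ ∈ ⁅⁅𝔎, 𝔎⁆, 𝔎⁆ :=
    fun x hx y hy => Subgroup.commutator_mem_commutator hx hy
  have hright : ∀ x ∈ 𝔎, ∀ y ∈ ⁅𝔎, 𝔎⁆, x * y * x⁻¹ * y⁻¹ ∈ ⁅⁅𝔎, 𝔎⁆, 𝔎⁆ := by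
    intro x hx y hy
    convert inv_mem (hleft y hy x hx) using 1
    group
  rintro x ((rfl | rfl) | hx) y hy
  · rcases hy with (rfl | rfl) | hy
    · simp
    · rw [ggsU_mul_ggsV]; simp
    · exact hright _ ggsU_mem_ggsK _ hy
  · rcases hy with (rfl | rfl) | hy
    · rw [← ggsU_mul_ggsV]; simp
    · simp
    · exact hright _ hV _ hy
  · exact hleft x hx y (hsK (Subgroup.subset_closure hy))

theorem ggsK_commutator_sec_eq :
    sec (ggsY0 * ggsY1 * ggsY0⁻¹ * ggsY1⁻¹) 0 = ggsY0⁻¹ ∧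
    sec (ggsY0 * ggsY1 * ggsY0⁻¹ * ggsY1⁻¹) 1 = ggsY1⁻¹ ∧
    sec (ggsY0 * ggsY1 * ggsY0⁻¹ * ggsY1⁻¹) 2 = 𝔟 * ggsY0 * 𝔟⁻¹ * ggsY0 := by
  have r1 := rootPerm_conj (g := 𝔞) rootPerm_ggsV
  have r2 := rootPerm_conj (g := 𝔟) r1
  have s1 := sec_conj_ggsA rootPerm_ggsV
  have s2 := sec_conj_ggsB r1
  have e : ggsY0 * ggsY1 * ggsY0⁻¹ * ggsY1⁻¹ =
      (𝔟 * (𝔞 * ggsV * 𝔞⁻¹) * 𝔟⁻¹)⁻¹ * ggsU := by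
    have h : 𝔟 * (𝔞 * ggsV * 𝔞⁻¹) * 𝔟⁻¹ =
        ggsY0 * (𝔞 * (𝔞 * ggsV * 𝔞⁻¹) * 𝔞⁻¹) * ggsY0⁻¹ := by rw [ggsB_eq]; group
    rw [h, conj_ggsV, conj_mul' 𝔞, conj_inv' 𝔞, conj_inv' 𝔞, conj_ggsV, ← ggsV, ggsU]
    group
  rw [e]
  simp only [sec_mul_of_rootPerm _ rootPerm_ggsU, sec_inv_of_rootPerm r2, s2, s1, sec_ggsU,
    sec_ggsV]
  refine ⟨by simp, by simp [ggsY1], by group⟩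

/-- `[y₀,y₁]⁻¹` has section `y₀` at `0`; conjugating it by `b` turns that section into `y₁`. -/
theorem exists_ggsK_commutator_sec_zero_eq {k : TreeAut 3} (hk : k ∈ 𝔎) :
    ∃ w ∈ ⁅𝔎, 𝔎⁆, rootPerm w = 1 ∧ sec w 0 = k := by
  have hr : ∀ w ∈ ⁅𝔎, 𝔎⁆, rootPerm w = 1 := fun w hw => mem_levelStab_one.1
    (commutator_le_levelStab_one (Subgroup.commutator_mono ggsK_le ggsK_le hw))
  have hc : ggsY0 * ggsY1 * ggsY0⁻¹ * ggsY1⁻¹ ∈ ⁅𝔎, 𝔎⁆ :=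
    Subgroup.commutator_mem_commutator ggsY0_mem ggsY1_mem
  have hinv := ggsInvariant_ggsK.commutator ggsInvariant_ggsK
  suffices ∃ w ∈ ⁅𝔎, 𝔎⁆, sec w 0 = k by
    obtain ⟨w, hw, h⟩ := this
    exact ⟨w, hw, hr w hw, h⟩
  have h0 : ∃ w ∈ ⁅𝔎, 𝔎⁆, sec w 0 = ggsY0 :=
    ⟨_, inv_mem hc, by rw [sec_inv_of_rootPerm (hr _ hc), ggsK_commutator_sec_eq.1, inv_inv]⟩
  refine ggsK_induction (P := fun k => ∃ w ∈ ⁅𝔎, 𝔎⁆, sec w 0 = k) ⟨1, one_mem _, rfl⟩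
    ?_ ?_ h0 ?_ hk
  · rintro _ _ ⟨w, hw, rfl⟩ ⟨v, hv, rfl⟩
    exact ⟨w * v, mul_mem hw hv, sec_mul_of_rootPerm _ (hr v hv) _⟩
  · rintro _ ⟨w, hw, rfl⟩
    exact ⟨w⁻¹, inv_mem hw, sec_inv_of_rootPerm (hr w hw) _⟩
  · obtain ⟨w, hw, h⟩ := h0
    exact ⟨_, hinv _ ggsB_mem _ hw, by rw [(sec_conj_ggsB (hr w hw)).1, h, conj_ggsY0]⟩

open scoped commutatorElement in
theorem branch_ggs_derived_le :
    branch ⁅⁅𝔊, 𝔊⁆, ⁅𝔊, 𝔊⁆⁆ ≤ ⁅⁅𝔎, 𝔎⁆, ⁅𝔎, 𝔎⁆⁆ := by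
  have hinv := ggsInvariant_ggsK.commutator ggsInvariant_ggsK
  have hsub : branch ⁅𝔎, 𝔎⁆ ≤ ⁅𝔎, 𝔎⁆ := ggs_derived_eq ▸ ggs_derived_le.trans
    (Subgroup.commutator_mono (Subgroup.commutator_le_self _) le_rfl)
  refine branch_le_of_atZero (hinv.commutator hinv) fun x hx => ?_
  -- For `c ∈ K'` and `w ∈ K'` with section `k` at `0`, both `(c, 1, 1)` and `w` lie in `K'`, and
  -- their commutator is `([c,k], 1, 1)`.
  suffices ⁅⁅𝔎, 𝔎⁆, 𝔎⁆ ≤ Subgroup.comap atZero ⁅⁅𝔎, 𝔎⁆, ⁅𝔎, 𝔎⁆⁆ from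
    this (ggs_derived_le hx)
  rw [Subgroup.commutator_le]
  intro c hc k hk
  obtain ⟨w, hw, hw1, rfl⟩ := exists_ggsK_commutator_sec_zero_eq hk
  have hcz : atZero c ∈ ⁅𝔎, 𝔎⁆ := hsub (mem_branch.2 ⟨rootPerm_atZero c, fun i => by
    rw [sec_atZero]; split_ifs; exacts [hc, one_mem _]⟩)
  rw [Subgroup.mem_comap]
  convert Subgroup.commutator_mem_commutator hcz hw using 1
  have e : ⁅c, sec w 0⁆ = c * (sec w 0 * c⁻¹ * (sec w 0)⁻¹) := by
    rw [commutatorElement_def]; group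
  rw [e, map_mul, atZero_conj_sec hw1, map_inv, commutatorElement_def]
  group

/-! ### Level stabilizers and the abelian quotients `G / G'`, `K / K'` and `K' / G''` -/

theorem finRotate_three_zpow_eq_one {n : ℤ} : finRotate 3 ^ n = 1 ↔ (3 : ℤ) ∣ n := by
  have h : orderOf (finRotate 3) = 3 := orderOf_eq_prime (by decide) (by decide)
  rw [← orderOf_dvd_iff_zpow_eq_one, h]
  rfl

theorem rootPerm_zpow {d : ℕ} (g : TreeAut d) (n : ℤ) : rootPerm (g ^ n) = rootPerm g ^ n :=
  map_zpow (MonoidHom.mk' (rootPerm (d := d)) rootPerm_mul) g n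

theorem rootPerm_ggsA_zpow (n : ℤ) : rootPerm (𝔞 ^ n) = 1 ↔ (3 : ℤ) ∣ n := by
  rw [rootPerm_zpow, rootPerm_ggsA, finRotate_three_zpow_eq_one]

theorem ggsA_zpow_eq_one {n : ℤ} (hn : (3 : ℤ) ∣ n) : 𝔞 ^ n = 1 := by
  obtain ⟨m, rfl⟩ := hn
  rw [zpow_mul, show 𝔞 ^ (3 : ℤ) = 1 from ggsA_pow_three, one_zpow]

theorem ggsB_zpow_eq_one {n : ℤ} (hn : (3 : ℤ) ∣ n) : 𝔟 ^ n = 1 := by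
  obtain ⟨m, rfl⟩ := hn
  rw [zpow_mul, show 𝔟 ^ (3 : ℤ) = 1 from ggsB_pow_three, one_zpow]

theorem rootPerm_eq_one_of_mem_commutator {g : TreeAut 3} (hg : g ∈ ⁅𝔊, 𝔊⁆) :
    rootPerm g = 1 := mem_levelStab_one.1 (commutator_le_levelStab_one hg)

theorem exists_abClass_ggs_eq {g : TreeAut 3} (hg : g ∈ 𝔊) :
    ∃ i j : ℤ, abClass 𝔊 g = i • abClass 𝔊 𝔞 + j • abClass 𝔊 𝔟 := by
  refine (ggs_induction (P := fun g => g ∈ 𝔊 ∧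
    ∃ i j : ℤ, abClass 𝔊 g = i • abClass 𝔊 𝔞 + j • abClass 𝔊 𝔟) ?_ ?_ ?_ ?_ hg).2
  · exact ⟨one_mem _, 0, 0, by simp [abClass_one]⟩
  · rintro g h ⟨hg, i, j, e⟩ ⟨hh, k, l, e'⟩
    refine ⟨mul_mem hg hh, i + k, j + l, ?_⟩
    rw [abClass_mul hg hh, e, e', add_smul, add_smul]
    abel
  · exact ⟨ggsA_mem, 1, 0, by simp⟩
  · exact ⟨ggsB_mem, 0, 1, by simp⟩

theorem exists_eq_ggsA_zpow_mul_ggsB_zpow_mul {g : TreeAut 3} (hg : g ∈ 𝔊) :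
    ∃ i j : ℤ, ∃ c ∈ ⁅𝔊, 𝔊⁆, g = 𝔞 ^ i * 𝔟 ^ j * c := by
  obtain ⟨i, j, h⟩ := exists_abClass_ggs_eq hg
  have ha := zpow_mem ggsA_mem i
  have hb := zpow_mem ggsB_mem j
  refine ⟨i, j, exists_eq_mul_of_abClass_eq hg (mul_mem ha hb) ?_⟩
  rw [h, abClass_mul ha hb, abClass_zpow ggsA_mem, abClass_zpow ggsB_mem]

theorem exists_eq_ggsB_zpow_mul {g : TreeAut 3} (hg : g ∈ 𝔊) (h1 : rootPerm g = 1) :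
    ∃ j : ℤ, ∃ c ∈ ⁅𝔊, 𝔊⁆, g = 𝔟 ^ j * c := by
  obtain ⟨i, j, c, hc, rfl⟩ := exists_eq_ggsA_zpow_mul_ggsB_zpow_mul hg
  rw [rootPerm_mul, rootPerm_mul, rootPerm_zpow 𝔟, rootPerm_ggsB, one_zpow,
    rootPerm_eq_one_of_mem_commutator hc, mul_one, mul_one, rootPerm_ggsA_zpow] at h1
  exact ⟨j, c, hc, by rw [ggsA_zpow_eq_one h1, one_mul]⟩

/-- Modulo `G'` an element of `K` is `bⁿa⁻ⁿ`; trivial action on the first level forces `3 ∣ n`, and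
both powers vanish. -/
theorem ggsK_inf_levelStab_one_le {g : TreeAut 3} (hg : g ∈ 𝔎) (h1 : rootPerm g = 1) :
    g ∈ ⁅𝔊, 𝔊⁆ := by
  have ha := ggsA_mem
  have hb := ggsB_mem
  have h0 : ggsY0 ∈ 𝔊 := ggsK_le ggsY0_mem
  have e0 : abClass 𝔊 ggsY1 = abClass 𝔊 ggsY0 := by
    rw [ggsY1, abClass_mul (mul_mem ha h0) (inv_mem ha), abClass_mul ha h0, abClass_inv ha,
      add_neg_cancel_comm]
  obtain ⟨-, n, hn⟩ : g ∈ 𝔊 ∧ ∃ n : ℤ, abClass 𝔊 g = n • abClass 𝔊 ggsY0 := by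
    refine ggsK_induction (P := fun g => g ∈ 𝔊 ∧ ∃ n : ℤ, abClass 𝔊 g = n • abClass 𝔊 ggsY0)
      ?_ ?_ ?_ ?_ ?_ hg
    · exact ⟨one_mem _, 0, by simp [abClass_one]⟩
    · rintro g h ⟨hg, i, e⟩ ⟨hh, k, e'⟩
      exact ⟨mul_mem hg hh, i + k, by rw [abClass_mul hg hh, e, e', add_smul]⟩
    · rintro g ⟨hg, i, e⟩
      exact ⟨inv_mem hg, -i, by rw [abClass_inv hg, e, neg_smul]⟩
    · exact ⟨h0, 1, by simp⟩
    · exact ⟨ggsK_le ggsY1_mem, 1, by simp [e0]⟩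
  rw [ggsY0, abClass_mul hb (inv_mem ha), abClass_inv ha, smul_add, smul_neg,
    ← abClass_zpow ha, ← abClass_zpow hb, ← abClass_inv (zpow_mem ha n),
    ← abClass_mul (zpow_mem hb n) (inv_mem (zpow_mem ha n))] at hn
  obtain ⟨c, hc, rfl⟩ := exists_eq_mul_of_abClass_eq (ggsK_le hg)
    (mul_mem (zpow_mem hb n) (inv_mem (zpow_mem ha n))) hn
  rw [rootPerm_mul, rootPerm_mul, rootPerm_zpow 𝔟, rootPerm_ggsB, one_zpow,
    rootPerm_eq_one_of_mem_commutator hc, mul_one, one_mul, rootPerm_inv, inv_eq_one,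
    rootPerm_ggsA_zpow] at h1
  simpa [ggsA_zpow_eq_one h1, ggsB_zpow_eq_one h1] using hc

theorem ggs_inf_levelStab_two_le {g : TreeAut 3} (hg : g ∈ 𝔊) (h2 : g ∈ levelStab 3 2) :
    g ∈ ⁅𝔊, 𝔊⁆ := by
  rw [mem_levelStab_succ] at h2
  obtain ⟨j, c, hc, rfl⟩ := exists_eq_ggsB_zpow_mul hg h2.1
  obtain ⟨hc1, hcK, hsum⟩ := ggs_commutator_sections hc
  have hsec : ∀ x, rootPerm (sec 𝔟 x) ^ j * rootPerm (sec c x) = 1 := fun x => by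
    have h := mem_levelStab_one.1 (h2.2 x)
    have hz : ∀ n : ℕ, sec (𝔟 ^ (n : ℤ)) x = sec 𝔟 x ^ (n : ℤ) := fun n => by
      rw [zpow_natCast, zpow_natCast, sec_pow (rootPerm_ggsB 3)]
    have hz' : sec (𝔟 ^ j) x = sec 𝔟 x ^ j := by
      obtain ⟨n, rfl | rfl⟩ := j.eq_nat_or_neg
      · exact hz n
      · rw [zpow_neg, zpow_neg, sec_inv_of_rootPerm (by
          rw [rootPerm_zpow, rootPerm_ggsB, one_zpow]), hz]
    rwa [sec_mul_of_rootPerm _ hc1, hz', rootPerm_mul, rootPerm_zpow] at h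
  have hprod : rootPerm (sec c 0) * rootPerm (sec c 1) * rootPerm (sec c 2) = 1 := by
    rw [← abClass_mul (hcK 0) (hcK 1), ← abClass_mul (mul_mem (hcK 0) (hcK 1)) (hcK 2),
      abClass_eq_zero_iff (mul_mem (mul_mem (hcK 0) (hcK 1)) (hcK 2))] at hsum
    rw [← rootPerm_mul, ← rootPerm_mul]
    exact rootPerm_eq_one_of_mem_commutator (Subgroup.commutator_mono ggsK_le ggsK_le hsum)
  have e0 := hsec 0
  have e1 := hsec 1
  have e2 := hsec 2
  rw [sec_ggsB_zero, rootPerm_ggsA] at e0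
  rw [sec_ggsB_one, rootPerm_ggsA] at e1
  rw [sec_ggsB_two, rootPerm_ggsB, one_zpow, one_mul] at e2
  -- The sections of `c` act on their first level by rotation exponents `-j, -j, 0`, whose sum is
  -- trivial by the zero-sum condition; so `3 ∣ 2j`, hence `3 ∣ j`.
  rw [eq_inv_of_mul_eq_one_right e0, eq_inv_of_mul_eq_one_right e1, e2, mul_one, ← zpow_neg,
    ← zpow_add, finRotate_three_zpow_eq_one] at hprod
  rw [ggsB_zpow_eq_one (by omega), one_mul]
  exact hc

/-- These are test elements of `G'` with known section classes and known class in `K/K'`. They are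
built from `U` for `y₀` and from `bUb⁻¹` for `y₁`. -/
theorem exists_sections_and_abClass {x : TreeAut 3} (hx : x ∈ 𝔎) :
    ∃ w ∈ ⁅𝔊, 𝔊⁆, abClass 𝔎 (sec w 0) = -abClass 𝔎 x ∧ abClass 𝔎 (sec w 1) = 0 ∧
      abClass 𝔎 (sec w 2) = abClass 𝔎 x ∧
      abClass 𝔎 w = abClass 𝔎 x - ggsTau (abClass 𝔎 x) := by
  have hK {w} (hw : w ∈ ⁅𝔊, 𝔊⁆) : w ∈ 𝔎 := ggs_commutator_le_ggsK hw
  have hr {w} (hw : w ∈ ⁅𝔊, 𝔊⁆) : rootPerm w = 1 := rootPerm_eq_one_of_mem_commutator hw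
  have hs {w} (hw : w ∈ ⁅𝔊, 𝔊⁆) : ∀ x, sec w x ∈ 𝔎 := (ggs_commutator_sections hw).2.1
  have hU := ggsU_mem_commutator
  have ht : ggsTau (abClass 𝔎 ggsY0) = abClass 𝔎 ggsY1 := (abClass_conj_ggsA ggsY0_mem).symm
  have haU : abClass 𝔎 ggsU = abClass 𝔎 ggsY0 - abClass 𝔎 ggsY1 := by
    rw [ggsU, abClass_mul ggsY0_mem (inv_mem ggsY1_mem), abClass_inv ggsY1_mem, sub_eq_add_neg]
  obtain ⟨u0, u1, u2⟩ := sec_ggsU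
  refine (ggsK_induction (P := fun x => x ∈ 𝔎 ∧ ∃ w ∈ ⁅𝔊, 𝔊⁆,
    abClass 𝔎 (sec w 0) = -abClass 𝔎 x ∧ abClass 𝔎 (sec w 1) = 0 ∧
      abClass 𝔎 (sec w 2) = abClass 𝔎 x ∧
      abClass 𝔎 w = abClass 𝔎 x - ggsTau (abClass 𝔎 x)) ?_ ?_ ?_ ?_ ?_ hx).2
  · exact ⟨one_mem _, 1, one_mem _, by simp [sec_one, abClass_one]⟩
  · rintro g h ⟨hg, w, hw, w0, w1, w2, w3⟩ ⟨hh, v, hv, v0, v1, v2, v3⟩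
    refine ⟨mul_mem hg hh, w * v, mul_mem hw hv, ?_⟩
    simp only [sec_mul_of_rootPerm _ (hr hv), abClass_mul (hs hw _) (hs hv _),
      abClass_mul (hK hw) (hK hv), abClass_mul hg hh, w0, w1, w2, w3, v0, v1, v2, v3, map_add]
    exact ⟨by abel, by simp, trivial, by abel⟩
  · rintro g ⟨hg, w, hw, w0, w1, w2, w3⟩
    refine ⟨inv_mem hg, w⁻¹, inv_mem hw, ?_⟩
    simp only [sec_inv_of_rootPerm (hr hw), abClass_inv (hs hw _),
      abClass_inv (hK hw), abClass_inv hg, w0, w1, w2, w3, map_neg]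
    exact ⟨trivial, by simp, trivial, by abel⟩
  · refine ⟨ggsY0_mem, ggsU, hU, ?_⟩
    rw [u0, u1, u2, abClass_inv ggsY0_mem, abClass_one, haU, ht]
    exact ⟨rfl, rfl, rfl, rfl⟩
  · refine ⟨ggsY1_mem, 𝔟 * ggsU * 𝔟⁻¹,
      (ggsInvariant_ggs.commutator ggsInvariant_ggs) _ ggsB_mem _ hU, ?_⟩
    obtain ⟨s0, s1, s2⟩ := sec_conj_ggsB rootPerm_ggsU
    rw [s0, s1, s2, abClass_conj_ggsA (hs hU 0), abClass_conj_ggsA (hs hU 1),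
      abClass_conj_ggsB (hs hU 2), abClass_conj_ggsB (hK hU), u0, u1, u2,
      abClass_inv ggsY0_mem, abClass_one, haU, map_neg, map_zero, map_sub, ht]
    exact ⟨rfl, rfl, rfl, rfl⟩

theorem branch_commutator_le : branch ⁅𝔎, 𝔎⁆ ≤ ⁅𝔎, 𝔎⁆ :=
  ggs_derived_eq ▸ Subgroup.commutator_mono ggs_commutator_le_ggsK ggs_commutator_le_ggsK

theorem one_sub_ggsTau_apply (z : Additive (Abelianization 𝔎)) :
    (1 - ggsTau) z = z - ggsTau z := rfl

/-- Correcting `k` by test elements kills all its section classes. The result lies in `K' × K' × K'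
≤ K'`, so the class of `k` is read off from the correction. -/
theorem abClass_eq_of_mem_commutator {k : TreeAut 3} (hk : k ∈ ⁅𝔊, 𝔊⁆) :
    abClass 𝔎 k = (1 - ggsTau) (ggsTau (ggsTau (abClass 𝔎 (sec k 1))) - abClass 𝔎 (sec k 0)) := by
  have hK {w} (hw : w ∈ ⁅𝔊, 𝔊⁆) : w ∈ 𝔎 := ggs_commutator_le_ggsK hw
  have hr {w} (hw : w ∈ ⁅𝔊, 𝔊⁆) : rootPerm w = 1 := rootPerm_eq_one_of_mem_commutator hw
  have hs {w} (hw : w ∈ ⁅𝔊, 𝔊⁆) : ∀ x, sec w x ∈ 𝔎 := (ggs_commutator_sections hw).2.1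
  have hinv := (ggsInvariant_ggs.commutator ggsInvariant_ggs) _ ggsA_mem
  obtain ⟨v, hv, v0, v1, v2, v3⟩ := exists_sections_and_abClass (hs hk 0)
  obtain ⟨w, hw, w0, w1, w2, w3⟩ := exists_sections_and_abClass (hs hk 1)
  -- Conjugating `w` twice by `a` moves its section classes `(-z, 0, z)` to `(0, z, -z)`, where `z`
  -- is the class of `sec k 1`.
  have hw' := hinv _ hw
  have hw'' := hinv _ hw'
  have s := sec_conj_ggsA (hr hw)
  have s' := sec_conj_ggsA (hr hw')
  have hkv := mul_mem hk hv
  have hmem : k * v * (𝔞 * (𝔞 * w * 𝔞⁻¹) * 𝔞⁻¹)⁻¹ ∈ ⁅𝔊, 𝔊⁆ := mul_mem hkv (inv_mem hw'')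
  have hsec : ∀ x, abClass 𝔎 (sec (k * v * (𝔞 * (𝔞 * w * 𝔞⁻¹) * 𝔞⁻¹)⁻¹) x) =
      abClass 𝔎 (sec k x) + abClass 𝔎 (sec v x) -
        abClass 𝔎 (sec (𝔞 * (𝔞 * w * 𝔞⁻¹) * 𝔞⁻¹) x) := fun x => by
    rw [sec_mul_of_rootPerm _ (hr (inv_mem hw'')), sec_mul_of_rootPerm _ (hr hv),
      sec_inv_of_rootPerm (hr hw''), abClass_mul (mul_mem (hs hk x) (hs hv x))
        (inv_mem (hs hw'' x)), abClass_mul (hs hk x) (hs hv x), abClass_inv (hs hw'' x),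
      sub_eq_add_neg]
  have hsum := (ggs_commutator_sections hk).2.2
  have hzero : abClass 𝔎 (k * v * (𝔞 * (𝔞 * w * 𝔞⁻¹) * 𝔞⁻¹)⁻¹) = 0 := by
    rw [abClass_eq_zero_iff (hK hmem)]
    refine branch_commutator_le (mem_branch.2 ⟨hr hmem, fun x => ?_⟩)
    rw [← abClass_eq_zero_iff (hs hmem x), hsec]
    revert x
    rw [forall_fin_three]
    simp only [s, s', v0, v1, v2, w0, w1, w2]
    refine ⟨by abel, by abel, ?_⟩
    -- The last coordinate vanishes because the section classes of `k` sum to zero.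
    rw [← hsum]
    abel
  rw [abClass_mul (hK hkv) (inv_mem (hK hw'')), abClass_mul (hK hk) (hK hv),
    abClass_inv (hK hw''), abClass_conj_ggsA (hK hw'), abClass_conj_ggsA (hK hw), v3, w3,
    add_neg_eq_zero] at hzero
  rw [eq_sub_of_add_eq hzero]
  simp only [map_sub, one_sub_ggsTau_apply]

/-- Each level fixed contributes one factor `1 - τ`, which commutes with `τ`. -/
theorem exists_abClass_eq_pow_apply (m : ℕ) : ∀ k ∈ 𝔎, k ∈ levelStab 3 m →
    ∃ z, abClass 𝔎 k = ((1 - ggsTau) ^ m) z := by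
  induction m with
  | zero => exact fun k _ _ => ⟨abClass 𝔎 k, rfl⟩
  | succ m ih =>
    intro k hk hm
    rw [mem_levelStab_succ] at hm
    have hc := ggsK_inf_levelStab_one_le hk hm.1
    have hs := (ggs_commutator_sections hc).2.1
    obtain ⟨z0, h0⟩ := ih _ (hs 0) (hm.2 0)
    obtain ⟨z1, h1⟩ := ih _ (hs 1) (hm.2 1)
    have hcomm : Commute ggsTau ((1 - ggsTau) ^ m) :=
      ((Commute.one_right _).sub_right (Commute.refl _)).pow_right m
    have hcomm' : ∀ z, ggsTau (((1 - ggsTau) ^ m) z) = ((1 - ggsTau) ^ m) (ggsTau z) :=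
      fun z => DFunLike.congr_fun hcomm.eq z
    refine ⟨ggsTau (ggsTau z1) - z0, ?_⟩
    rw [abClass_eq_of_mem_commutator hc, h0, h1, hcomm', hcomm', ← map_sub, pow_succ']
    rfl

theorem one_sub_ggsTau_sq : (1 - ggsTau) ^ 2 = 3 * (-ggsTau) := by
  have h : (1 - ggsTau) ^ 2 = (1 + ggsTau + ggsTau * ggsTau) + 3 * (-ggsTau) := by
    have h3 : (3 : AddMonoid.End (Additive (Abelianization 𝔎))) = 1 + 1 + 1 := by norm_num
    simp only [h3, sq, sub_mul, mul_sub, one_mul, mul_one, add_mul]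
    abel
  rw [h, ggsTau_relation, zero_add]

theorem exists_abClass_eq_nsmul (s : ℕ) {k : TreeAut 3} (hk : k ∈ 𝔎)
    (hm : k ∈ levelStab 3 (2 * s)) : ∃ x ∈ 𝔎, abClass 𝔎 k = 3 ^ s • abClass 𝔎 x := by
  obtain ⟨z, hz⟩ := exists_abClass_eq_pow_apply _ k hk hm
  obtain ⟨x, hx, hxz⟩ := exists_abClass_eq (((-ggsTau) ^ s) z)
  refine ⟨x, hx, ?_⟩
  have h3 : Commute (3 : AddMonoid.End (Additive (Abelianization 𝔎))) (-ggsTau) := by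
    exact_mod_cast Nat.cast_commute 3 (-ggsTau)
  have h3' : (3 : AddMonoid.End (Additive (Abelianization 𝔎))) ^ s = ((3 ^ s : ℕ) : _) := by
    push_cast; rfl
  rw [hz, hxz, pow_mul, one_sub_ggsTau_sq, h3.mul_pow, h3']
  rfl

theorem exists_eq_pow_mul_of_mem_ggsK (e : ℕ) : ∀ k ∈ 𝔎, k ∈ levelStab 3 (2 * e) →
    ∃ t ∈ 𝔎, ∃ r ∈ ⁅𝔎, 𝔎⁆, k = t ^ 3 ^ e * r := by
  intro k hk hm
  obtain ⟨t, ht, h⟩ := exists_abClass_eq_nsmul e hk hm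
  exact ⟨t, ht, exists_eq_mul_of_abClass_eq hk (pow_mem ht _) (by rw [h, abClass_pow ht])⟩

theorem ggsK_commutator_sections {g : TreeAut 3} (hg : g ∈ ⁅𝔎, 𝔎⁆) :
    rootPerm g = 1 ∧ (∀ x, sec g x ∈ 𝔎) ∧
      abClass 𝔎 (sec g 1) = ggsTau (abClass 𝔎 (sec g 0)) ∧
      abClass 𝔎 (sec g 2) = ggsTau (abClass 𝔎 (sec g 1)) := by
  let M : AddSubgroup (Fin 3 → Additive (Abelianization 𝔎)) :=
    { carrier := {f | f 1 = ggsTau (f 0) ∧ f 2 = ggsTau (f 1)}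
      zero_mem' := by simp
      add_mem' := by
        rintro f f' ⟨h1, h2⟩ ⟨h1', h2'⟩
        exact ⟨by simp only [Pi.add_apply, map_add, h1, h1'],
          by simp only [Pi.add_apply, map_add, h2, h2']⟩
      neg_mem' := by
        rintro f ⟨h1, h2⟩
        exact ⟨by simp only [Pi.neg_apply, map_neg, h1],
          by simp only [Pi.neg_apply, map_neg, h2]⟩ }
  have hM : GgsInvariant (sectionSubgroup M) := by
    apply ggsInvariant_sectionSubgroup
    · rintro f ⟨h1, h2⟩
      refine ⟨?_, h1⟩
      change f 0 = ggsTau (f 2)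
      -- Rotation stability needs `τ³ = 1`, obtained as the difference of two instances of `1 + τ +
      -- τ² = 0`.
      have h := add_ggsTau_add_ggsTau (f 0)
      have h' := add_ggsTau_add_ggsTau (f 1)
      rw [← h1, ← h2] at h
      rw [← h2] at h'
      rw [← sub_eq_zero, ← sub_self (0 : Additive (Abelianization 𝔎))]
      nth_rewrite 1 [← h]
      rw [← h']
      abel
    · rintro f ⟨h1, h2⟩
      exact ⟨congrArg ggsTau h1, congrArg ggsTau h2⟩
  have hU : ggsY0 * ggsY1 * ggsY0⁻¹ * ggsY1⁻¹ ∈ sectionSubgroup M := by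
    have hc : ggsY0 * ggsY1 * ggsY0⁻¹ * ggsY1⁻¹ ∈ ⁅𝔊, 𝔊⁆ :=
      Subgroup.commutator_mem_commutator (ggsK_le ggsY0_mem) (ggsK_le ggsY1_mem)
    obtain ⟨h0, h1, h2⟩ := ggsK_commutator_sec_eq
    have hs := ggs_commutator_sections hc
    refine ⟨mem_branch.2 ⟨hs.1, hs.2.1⟩, ?_⟩
    have hsum := hs.2.2
    have ht : abClass 𝔎 (sec (ggsY0 * ggsY1 * ggsY0⁻¹ * ggsY1⁻¹) 1) =
        ggsTau (abClass 𝔎 (sec (ggsY0 * ggsY1 * ggsY0⁻¹ * ggsY1⁻¹) 0)) := by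
      rw [h0, h1, abClass_inv ggsY1_mem, abClass_inv ggsY0_mem, map_neg,
        ← abClass_conj_ggsA ggsY0_mem, conj_ggsY0]
    refine ⟨ht, ?_⟩
    change abClass 𝔎 _ = ggsTau (abClass 𝔎 _)
    rw [ht] at hsum ⊢
    exact add_left_cancel (hsum.trans (add_ggsTau_add_ggsTau _).symm)
  obtain ⟨h1, h2⟩ := ggsK_commutator_le hM hU hg
  exact ⟨(mem_branch.1 h1).1, (mem_branch.1 h1).2, h2⟩

/-- Modulo `K' × K' × K'` an element of `K'` is determined by the class of its section at `0`, so it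
suffices to match a `3^e`-th power there. Passing to that section costs the extra level in `2 * e +
1`. -/
theorem exists_eq_pow_mul_of_mem_ggsK_commutator (e : ℕ) :
    ∀ k ∈ ⁅𝔎, 𝔎⁆, k ∈ levelStab 3 (2 * e + 1) →
      ∃ t ∈ ⁅𝔎, 𝔎⁆, ∃ r ∈ branch ⁅𝔎, 𝔎⁆, k = t ^ 3 ^ e * r := by
  intro k hk hm
  rw [mem_levelStab_succ] at hm
  obtain ⟨x, hx, h⟩ := exists_abClass_eq_nsmul e ((ggsK_commutator_sections hk).2.1 0) (hm.2 0)
  obtain ⟨t, ht, ht1, rfl⟩ := exists_ggsK_commutator_sec_zero_eq hx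
  have hmem : (t ^ 3 ^ e)⁻¹ * k ∈ ⁅𝔎, 𝔎⁆ := mul_mem (inv_mem (pow_mem ht _)) hk
  obtain ⟨r1, rK, e1, e2⟩ := ggsK_commutator_sections hmem
  have e0 : abClass 𝔎 (sec ((t ^ 3 ^ e)⁻¹ * k) 0) = 0 := by
    have htr : rootPerm (t ^ 3 ^ e) = 1 := by rw [rootPerm_pow, ht1, one_pow]
    have hp := pow_mem hx (3 ^ e)
    rw [sec_mul_of_rootPerm _ hm.1, sec_inv_of_rootPerm htr, sec_pow ht1,
      abClass_mul (inv_mem hp) ((ggsK_commutator_sections hk).2.1 0), abClass_inv hp, h,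
      abClass_pow hx, neg_add_cancel]
  rw [e0, map_zero] at e1
  rw [e1, map_zero] at e2
  refine ⟨t, ht, _, mem_branch.2 ⟨r1, fun x => (abClass_eq_zero_iff (rK x)).1 ?_⟩,
    (mul_inv_cancel_left _ _).symm⟩
  revert x
  exact forall_fin_three.2 ⟨e0, e1, e2⟩

/-! ### The congruence subgroup property -/

/-- `N` is a normal subgroup of the group, with quotient of exponent a power of `3`. -/
structure IsThreeQuotient (N : Subgroup (TreeAut 3)) : Prop where
  le : N ≤ 𝔊
  invariant : GgsInvariant N
  exponent : ∃ e : ℕ, ∀ g ∈ 𝔊, g ^ 3 ^ e ∈ N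

/-- Every subgroup `N` as in `IsThreeQuotient` that contains `D` contains a level stabilizer. -/
def HasThreeCSPModulo (D : Subgroup (TreeAut 3)) : Prop :=
  ∀ N, IsThreeQuotient N → D ≤ N → ∃ m, 𝔊 ⊓ levelStab 3 m ≤ N

theorem pow_mem_levelStab (m : ℕ) : ∀ g ∈ 𝔊, g ^ 3 ^ m ∈ levelStab 3 m := by
  induction m with
  | zero => exact fun g _ => mem_levelStab_zero _
  | succ m ih =>
    intro g hg
    have h1 : rootPerm (g ^ 3) = 1 := by
      obtain ⟨n, hn⟩ := rootPerm_mem_zpowers hg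
      simp only at hn
      rw [rootPerm_pow, ← hn, ← zpow_natCast, ← zpow_mul, finRotate_three_zpow_eq_one]
      exact ⟨n, by push_cast; ring⟩
    rw [pow_succ', pow_mul, mem_levelStab_succ, rootPerm_pow, h1, one_pow]
    refine ⟨rfl, fun x => ?_⟩
    rw [sec_pow h1]
    exact ih _ (sec_mem_ggs (pow_mem hg 3) x)

theorem IsThreeQuotient.inf_levelStab {N : Subgroup (TreeAut 3)} (hN : IsThreeQuotient N)
    (m : ℕ) : IsThreeQuotient (N ⊓ levelStab 3 m) where
  le := inf_le_left.trans hN.le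
  invariant := fun g hg h hh => ⟨hN.invariant g hg h hh.1, conj_mem_levelStab m g hh.2⟩
  exponent := by
    obtain ⟨e, he⟩ := hN.exponent
    refine ⟨e + m, fun g hg => ⟨?_, ?_⟩⟩
    · rw [pow_add, pow_mul]
      exact pow_mem (he g hg) _
    · rw [pow_add, mul_comm, pow_mul]
      exact pow_mem (pow_mem_levelStab m g hg) _

/-- The product of two subgroups, the second of which is normalized by the first. -/
def mulSubgroup (N D : Subgroup (TreeAut 3)) (hN : N ≤ 𝔊) (hD : GgsInvariant D) :
    Subgroup (TreeAut 3) where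
  carrier := {g | ∃ n ∈ N, ∃ d ∈ D, g = n * d}
  one_mem' := ⟨1, one_mem _, 1, one_mem _, by simp⟩
  mul_mem' := by
    rintro _ _ ⟨n, hn, d, hd, rfl⟩ ⟨n', hn', d', hd', rfl⟩
    refine ⟨n * n', mul_mem hn hn', n'⁻¹ * d * n'⁻¹⁻¹ * d',
      mul_mem (hD _ (hN (inv_mem hn')) d hd) hd', by group⟩
  inv_mem' := by
    rintro _ ⟨n, hn, d, hd, rfl⟩
    exact ⟨n⁻¹, inv_mem hn, n * d⁻¹ * n⁻¹, hD _ (hN hn) _ (inv_mem hd), by group⟩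

/-- If the quotient by `N ≥ R` has exponent dividing `3^e`, the power condition gives `D ∩ st(m) ≤
N`. The hypothesis on `D` is then applied to `(N ∩ st(m))D`. -/
theorem HasThreeCSPModulo.step {D R : Subgroup (TreeAut 3)} (h : HasThreeCSPModulo D)
    (hDG : D ≤ 𝔊) (hD : GgsInvariant D)
    (hpow : ∀ e, ∃ m, ∀ k ∈ D, k ∈ levelStab 3 m → ∃ t ∈ D, ∃ r ∈ R, k = t ^ 3 ^ e * r) :
    HasThreeCSPModulo R := by
  intro N hN hRN
  obtain ⟨e, he⟩ := hN.exponent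
  obtain ⟨m, hm⟩ := hpow e
  have hm' : ∀ k ∈ D, k ∈ levelStab 3 m → k ∈ N := by
    intro k hk hkm
    obtain ⟨t, ht, r, hr, rfl⟩ := hm k hk hkm
    exact mul_mem (he t (hDG ht)) (hRN hr)
  have hN' := hN.inf_levelStab m
  have hprod : IsThreeQuotient (mulSubgroup _ D hN'.le hD) :=
    { le := by
        rintro _ ⟨n, hn, d, hd, rfl⟩
        exact mul_mem (hN'.le hn) (hDG hd)
      invariant := by
        rintro g hg _ ⟨n, hn, d, hd, rfl⟩
        exact ⟨_, hN'.invariant g hg n hn, _, hD g hg d hd, conj_mul' g n d⟩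
      exponent := by
        obtain ⟨e', he'⟩ := hN'.exponent
        exact ⟨e', fun g hg => ⟨_, he' g hg, 1, one_mem _, (mul_one _).symm⟩⟩ }
  obtain ⟨l, hl⟩ := h _ hprod fun d hd => ⟨1, one_mem _, d, hd, (one_mul d).symm⟩
  refine ⟨max l m, fun g hg => ?_⟩
  -- Both `nd` and `n` fix level `m`, hence so does `d`, which therefore lies in `D ∩ st(m) ≤ N`.
  obtain ⟨n, hn, d, hd, rfl⟩ := hl ⟨hg.1, levelStab_antitone (le_max_left l m) hg.2⟩
  refine mul_mem hn.1 (hm' d hd ?_)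
  exact ((levelStab 3 m).mul_mem_cancel_left hn.2).1
    (levelStab_antitone (le_max_right l m) hg.2)

theorem ggsInvariant_branch_iterate {H : Subgroup (TreeAut 3)} (hH : GgsInvariant H) (n : ℕ) :
    GgsInvariant (branch^[n] H) := by
  induction n with
  | zero => exact hH
  | succ n ih => rw [Function.iterate_succ_apply']; exact ih.branch

theorem branch_iterate_mono {d : ℕ} (n : ℕ) : Monotone (branch (d := d))^[n] :=
  Monotone.iterate (fun _ _ => branch_mono) n

theorem commutator_branch_iterate {d : ℕ} (H : Subgroup (TreeAut d)) (n : ℕ) :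
    ⁅branch^[n] H, branch^[n] H⁆ = branch^[n] ⁅H, H⁆ := by
  induction n with
  | zero => rfl
  | succ n ih => rw [Function.iterate_succ_apply', Function.iterate_succ_apply',
      commutator_branch, ih]

theorem branch_iterate_commutator_le (n : ℕ) : branch^[n] ⁅𝔎, 𝔎⁆ ≤ ⁅𝔎, 𝔎⁆ := by
  induction n with
  | zero => exact le_rfl
  | succ n ih =>
    rw [Function.iterate_succ_apply']
    exact (branch_mono ih).trans branch_commutator_le

theorem hasThreeCSPModulo_ggsK : HasThreeCSPModulo 𝔎 := fun _ _ hK =>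
  ⟨2, fun _ hg => hK (ggs_commutator_le_ggsK (ggs_inf_levelStab_two_le hg.1 hg.2))⟩

theorem hasThreeCSPModulo_branch_iterate (n : ℕ) :
    HasThreeCSPModulo (branch^[n] ⁅𝔎, 𝔎⁆) := by
  induction n with
  | zero =>
    exact hasThreeCSPModulo_ggsK.step ggsK_le ggsInvariant_ggsK
      fun e => ⟨_, exists_eq_pow_mul_of_mem_ggsK e⟩
  | succ n ih =>
    refine ih.step ((branch_iterate_commutator_le n).trans
      ((Subgroup.commutator_le_self _).trans ggsK_le))
      (ggsInvariant_branch_iterate (ggsInvariant_ggsK.commutator ggsInvariant_ggsK) n)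
      fun e => ⟨2 * e + 1 + n, ?_⟩
    clear ih
    induction n with
    | zero => exact exists_eq_pow_mul_of_mem_ggsK_commutator e
    | succ n ih =>
      rw [Function.iterate_succ_apply', Function.iterate_succ_apply' branch (n + 1)]
      exact exists_branch_mul_pow ih

/-- One more derivation replaces `K'` by `K''`, which contains the direct power of `G''`, itself the
direct power of `K'`. So each derived step costs two levels, starting from `ψ(G'') = K' × K' × K'`.
-/
theorem branch_iterate_le_derivedSeries (n : ℕ) :
    branch^[2 * n + 1] ⁅𝔎, 𝔎⁆ ≤ (derivedSeries 𝔊 (n + 2)).map (𝔊).subtype := by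
  induction n with
  | zero =>
    have h : (derivedSeries 𝔊 2).map (𝔊).subtype = ⁅⁅𝔊, 𝔊⁆, ⁅𝔊, 𝔊⁆⁆ := by
      simp only [derivedSeries_succ, derivedSeries_zero, Subgroup.map_commutator,
        ← MonoidHom.range_eq_map, Subgroup.range_subtype]
    exact (ggs_derived_eq.symm.trans h.symm).le
  | succ n ih =>
    rw [derivedSeries_succ, Subgroup.map_commutator]
    refine le_trans ?_ (Subgroup.commutator_mono ih ih)
    rw [commutator_branch_iterate]
    have h := branch_iterate_mono (2 * n + 1) branch_ggs_derived_le
    rwa [ggs_derived_eq, ← Function.iterate_succ_apply, ← Function.iterate_succ_apply] at h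

theorem hasPCSP_ggs : HasPCSP 3 𝔊 := by
  rintro N hN ⟨hfin, hp⟩
  have hN3 : IsThreeQuotient (N.map (𝔊).subtype) :=
    { le := Subgroup.map_subtype_le N
      invariant := by
        rintro g hg _ ⟨h, hh, rfl⟩
        exact ⟨⟨g, hg⟩ * h * ⟨g, hg⟩⁻¹, hN.conj_mem h hh _, rfl⟩
      exponent := by
        have : Fact (Nat.Prime 3) := ⟨Nat.prime_three⟩
        obtain ⟨e, he⟩ := IsPGroup.iff_card.1 hp
        refine ⟨e, fun g hg => ⟨⟨g, hg⟩ ^ 3 ^ e, ?_, rfl⟩⟩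
        change (⟨g, hg⟩ : 𝔊) ^ 3 ^ e ∈ N
        rw [← QuotientGroup.eq_one_iff, QuotientGroup.mk_pow, ← he, pow_card_eq_one'] }
  obtain ⟨n, hn⟩ : ∃ n, derivedSeries 𝔊 n ≤ N := by
    have : Fact (Nat.Prime 3) := ⟨Nat.prime_three⟩
    have : Group.IsNilpotent (𝔊 ⧸ N) := hp.isNilpotent
    obtain ⟨n, hn⟩ := (inferInstance : Group.IsSolvable (𝔊 ⧸ N)).solvable
    refine ⟨n, ?_⟩
    rw [← QuotientGroup.ker_mk' N, ← Subgroup.map_eq_bot_iff,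
      map_derivedSeries_eq (QuotientGroup.mk'_surjective N), hn]
  obtain ⟨m, hm⟩ := hasThreeCSPModulo_branch_iterate (2 * n + 1) _ hN3
    ((branch_iterate_le_derivedSeries n).trans
      (Subgroup.map_mono ((derivedSeries_antitone 𝔊 (by omega)).trans hn)))
  refine ⟨m, fun g hg => ?_⟩
  obtain ⟨h, hh, e⟩ := hm ⟨g.2, hg⟩
  rwa [← Subtype.ext e]

end TreeAut

theorem mainTheorem4 :
    -- the group has the 3-CSP
    TreeAut.HasPCSP 3 (TreeAut.ggs 3) ∧
    -- ψ(G'') = K' × K' × K'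
    Subgroup.map (TreeAut.psi 3).toMonoidHom
        ⁅⁅TreeAut.ggs 3, TreeAut.ggs 3⁆, ⁅TreeAut.ggs 3, TreeAut.ggs 3⁆⁆ =
      TreeAut.basePower ⁅TreeAut.ggsK 3, TreeAut.ggsK 3⁆ ∧
    -- G'' ≤ γ₃(K) = [[K, K], K]
    ⁅⁅TreeAut.ggs 3, TreeAut.ggs 3⁆, ⁅TreeAut.ggs 3, TreeAut.ggs 3⁆⁆ ≤
      ⁅⁅TreeAut.ggsK 3, TreeAut.ggsK 3⁆, TreeAut.ggsK 3⁆ ∧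
    -- ψ(K'') ≥ G'' × G'' × G''
    TreeAut.basePower ⁅⁅TreeAut.ggs 3, TreeAut.ggs 3⁆, ⁅TreeAut.ggs 3, TreeAut.ggs 3⁆⁆ ≤
      Subgroup.map (TreeAut.psi 3).toMonoidHom
        ⁅⁅TreeAut.ggsK 3, TreeAut.ggsK 3⁆, ⁅TreeAut.ggsK 3, TreeAut.ggsK 3⁆⁆ := by
  refine ⟨TreeAut.hasPCSP_ggs, ?_, TreeAut.ggs_derived_le, ?_⟩
  · rw [TreeAut.ggs_derived_eq, TreeAut.map_psi_branch]
  · rw [← TreeAut.map_psi_branch]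
    exact Subgroup.map_mono TreeAut.branch_ggs_derived_le
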